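/- Let $n\ge 1$, $X=\{1,\dots,n\}$, and let $Q_n$ be the hypercube, i.e. the power set of $X$ with the metric $d(x,y)=|x\,\Delta\, y|$. Write $X^{(s)}$, $X^{(\le s)}$, $X^{(\ge s)}$ for the families of subsets of $X$ of size exactly, at most, at least $s$. For $A\subseteq Q_n$ and an integer $t>0$ let $N^t(A)$ be the set of all $x\in Q_n$ with $d(x,y)\le t$ for some $y\in A$, and let $A^c=Q_n\setminus A$. Call $A$ extremal if for every $t>0$ both $|N^t(A)|\le |N^t(B)|$ for all $B\subseteq Q_n$ with $|B|=|A|$, and $|N^t(A^c)|\le |N^t(B)|$ for all $B\subseteq Q_n$ with $|B|=|A^c|$. Two subsets of $Q_n$ are isomorphic if some automorphism (bijective isometry) of $Q_n$ maps one onto the other. The colexicographic order on $X^{(s)}$ is given by $B<C$ if $\max(B\,\Delta\, C)\in C$. For an initial segment $\mathcal A$ of the colexicographic order on $X^{(s)}$ with $|\mathcal A|\le\binom{n-1}{s}$ and for $1\le i\le n$, put $\mathcal A_{i,1}=\{B\subseteq X: i\notin B,\ B\in\mathcal A\}$, $\mathcal A_{i,0}=\{B\subseteq X: i\notin B,\ B\cup\{i\}\in\mathcal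 A\}$ and $$A_i=X^{(\ge s+1)}\cup\mathcal A_{i,1}\cup\mathcal A_{i,0}.$$ Theorem 2 (Classification of extremal sets). Let $r\ge 0$ and let $A\subseteq Q_n$ satisfy $$\left|X^{(\le r)}\right|<|A|\le\left|X^{(\le r)}\cup\{B\in X^{(r+1)}: 1\in B\}\right|=\left|X^{(\le r)}\right|+\binom{n-1}{r}.$$ Then there are an $s\ge 0$ and an initial segment $\mathcal A$ of the colexicographic order on $X^{(s)}$ with $|\mathcal A|\le\binom{n-1}{s}$ such that the sets $A_1,\dots,A_n$ built from $\mathcal A$ satisfy $|A_i|=|A|$ for all $i$; and for every such $s$ and $\mathcal A$, the set $A$ is extremal if and only if $A$ is isomorphic to $A_i$ for some $1\le i\le n$. -/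

import Mathlib

namespace Hypercube

/-- Distance in the `n`-dimensional hypercube, whose vertices are the subsets of an `n`-element
ground set (`Fin n`, standing for `{1, …, n}` in its natural order): `d(x, y) = |x Δ y|`. -/
def dist {n : ℕ} (x y : Finset (Fin n)) : ℕ := (symmDiff x y).card

/-- The `t`-neighbourhood `N^t(A)`: all vertices at distance at most `t` from some point of `A`. -/
def nbhd {n : ℕ} (t : ℕ) (A : Finset (Finset (Fin n))) : Finset (Finset (Fin n)) :=
  Finset.univ.filter fun x => ∃ y ∈ A, dist x y ≤ t

/-- For every `t > 0`, `N^t(A)` has minimal size among the `t`-neighbourhoods of the subsets of the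
hypercube that have the same size as `A`. -/
def MinimalNbhds {n : ℕ} (A : Finset (Finset (Fin n))) : Prop :=
  ∀ t : ℕ, 0 < t → ∀ B : Finset (Finset (Fin n)), B.card = A.card →
    (nbhd t A).card ≤ (nbhd t B).card

/-- `A` is extremal: `N^t(A)` and `N^t(Aᶜ)` are minimal for all `t > 0`. -/
def Extremal {n : ℕ} (A : Finset (Finset (Fin n))) : Prop :=
  MinimalNbhds A ∧ MinimalNbhds Aᶜ

/-- `A` and `B` are isomorphic: some automorphism (bijective isometry) of the hypercube maps `A`
onto `B`. -/
def Isomorphic {n : ℕ} (A B : Finset (Finset (Fin n))) : Prop :=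
  ∃ φ : Equiv.Perm (Finset (Fin n)), (∀ x y, dist (φ x) (φ y) = dist x y) ∧ A.image φ = B

/-- `X^{(≤ r)}`: the sets of size at most `r`. -/
def layersLE (n r : ℕ) : Finset (Finset (Fin n)) :=
  Finset.univ.filter fun B => B.card ≤ r

/-- `X^{(≥ r)}`: the sets of size at least `r`. -/
def layersGE (n r : ℕ) : Finset (Finset (Fin n)) :=
  Finset.univ.filter fun B => r ≤ B.card

/-- `G_r`: the sets of size at most `r`, together with the sets of size `r + 1` that contain the
first element of the ground set. -/
def ballG (n r : ℕ) : Finset (Finset (Fin n)) :=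
  layersLE n r ∪ Finset.univ.filter fun B => B.card = r + 1 ∧ ∃ i ∈ B, (i : ℕ) = 0

/-- For a family `𝒜` of `s`-element sets and an element `i`, the set
`A_i = X^{(≥ s + 1)} ∪ 𝒜_{i,1} ∪ 𝒜_{i,0}`, where `𝒜_{i,1} = {B : i ∉ B, B ∈ 𝒜}` and
`𝒜_{i,0} = {B : i ∉ B, B ∪ {i} ∈ 𝒜}` are the `i`-sections of `𝒜`. -/
def sectionSet {n : ℕ} (s : ℕ) (𝒜 : Finset (Finset (Fin n))) (i : Fin n) :
    Finset (Finset (Fin n)) :=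
  layersGE n (s + 1) ∪ 𝒜.nonMemberSubfamily i ∪ 𝒜.memberSubfamily i

/-- `𝒜` is an initial segment of the colexicographic order on the `s`-element sets, of size at most
`C(n - 1, s)`, and the sets `A_1, …, A_n` built from it all have size `m`. -/
def Generates {n : ℕ} (s : ℕ) (𝒜 : Finset (Finset (Fin n))) (m : ℕ) : Prop :=
  Finset.Colex.IsInitSeg 𝒜 s ∧ 𝒜.card ≤ (n - 1).choose s ∧
    ∀ i : Fin n, (sectionSet s 𝒜 i).card = m

end Hypercube

/-! Extremality of `A_i`. Order the subsets of X by decreasing size, then by colex. The segments of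
this order minimise the 1-neighbourhood (`IsSegment.card_nbhd_one_le`, proved by UV-compressions),
and X^(≥s+1) ∪ 𝒜 is a segment with as many elements as `A_i`. Forming the neighbourhood replaces 𝒜
by its shadow, both for this segment and for `A_i` (`nbhd_one_sectionSet`). Shadows of colex
segments are colex segments, so induction on t shows that N^t(A_i) is minimal. Complements of the
sets `A_i` are isomorphic to sets of the same kind (`isomorphic_compl_sectionSet`), which settles
the other half of extremality.

Conversely, compare an extremal A with `A_i`, where i is the last element; the bound on |𝒜| makes
every member of 𝒜 avoid it. Since N^(n-1-s)(A_iᶜ) misses X, N^(n-1-s)(Aᶜ) misses a point, and after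
a translation A contains X^(≥s+1). For s ≥ 1, N^(s-1)(A_i) misses both ∅ and {i}, so N^(s-1)(A)
misses a nonempty set, which must be a singleton {k}. Hence A is the section set at k of some family
E of s-sets with |E| = |𝒜| (`exists_eq_sectionSet`).

Extremality now says that all iterated shadows of E are as small as those of 𝒜 and, through the
complement, that E spans as many cliques. These counts together determine a colex segment up to a
permutation of X (`exists_image_eq_of_isInitSeg`), although the size of a single shadow need not. -/

section

open scoped FinsetFamily

namespace Hypercube

variable {n : ℕ} {A B : Finset (Finset (Fin n))} {x y z : Finset (Fin n)} {s t : ℕ} {i : Fin n}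

/-! ### Neighbourhoods -/

lemma dist_self (x : Finset (Fin n)) : dist x x = 0 := by simp [dist]

lemma dist_triangle (x y z : Finset (Fin n)) : dist x z ≤ dist x y + dist y z := by
  unfold dist
  exact (Finset.card_le_card (symmDiff_triangle x y z)).trans (Finset.card_union_le _ _)

lemma dist_eq_zero : dist x y = 0 ↔ x = y := by
  simp [dist, symmDiff_eq_bot, ← Finset.bot_eq_empty]

lemma dist_symmDiff_singleton (x : Finset (Fin n)) (d : Fin n) :
    dist x (symmDiff x {d}) = 1 := by
  simp [dist]

lemma mem_nbhd : x ∈ nbhd t A ↔ ∃ y ∈ A, dist x y ≤ t := by simp [nbhd]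

lemma nbhd_mono (h : A ⊆ B) : nbhd t A ⊆ nbhd t B := fun x hx ↦ by
  obtain ⟨y, hy, hxy⟩ := mem_nbhd.1 hx
  exact mem_nbhd.2 ⟨y, h hy, hxy⟩

lemma subset_nbhd : A ⊆ nbhd t A := fun x hx ↦ mem_nbhd.2 ⟨x, hx, by simp [dist_self]⟩

lemma nbhd_zero (A : Finset (Finset (Fin n))) : nbhd 0 A = A := by
  ext x
  simp [mem_nbhd, dist_eq_zero]

lemma nbhd_empty : nbhd t (∅ : Finset (Finset (Fin n))) = ∅ := by
  ext x
  simp [mem_nbhd]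

lemma nbhd_succ (t : ℕ) (A : Finset (Finset (Fin n))) : nbhd (t + 1) A = nbhd 1 (nbhd t A) := by
  ext x
  constructor
  · intro hx
    obtain ⟨y, hy, hxy⟩ := mem_nbhd.1 hx
    obtain h | ⟨d, hd⟩ := (symmDiff x y).eq_empty_or_nonempty
    · have : x = y := by simpa [symmDiff_eq_bot, ← Finset.bot_eq_empty] using h
      exact subset_nbhd (subset_nbhd (this ▸ hy))
    refine mem_nbhd.2 ⟨symmDiff x {d}, mem_nbhd.2 ⟨y, hy, ?_⟩, (dist_symmDiff_singleton x d).le⟩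
    have : symmDiff (symmDiff x {d}) y = (symmDiff x y).erase d := by
      ext a
      simp only [Finset.mem_symmDiff, Finset.mem_erase, Finset.mem_singleton] at hd ⊢
      grind
    unfold dist at hxy ⊢
    rw [this, Finset.card_erase_of_mem hd]
    omega
  · intro hx
    obtain ⟨y, hy, hxy⟩ := mem_nbhd.1 hx
    obtain ⟨z, hz, hyz⟩ := mem_nbhd.1 hy
    exact mem_nbhd.2 ⟨z, hz, (dist_triangle x y z).trans (by omega)⟩

lemma mem_nbhd_one : x ∈ nbhd 1 A ↔ x ∈ A ∨ ∃ d, symmDiff x {d} ∈ A := by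
  rw [mem_nbhd]
  constructor
  · rintro ⟨y, hy, hxy⟩
    obtain h | h := Nat.le_one_iff_eq_zero_or_eq_one.1 hxy
    · exact Or.inl (dist_eq_zero.1 h ▸ hy)
    · obtain ⟨d, hd⟩ := Finset.card_eq_one.1 h
      refine Or.inr ⟨d, ?_⟩
      rwa [← hd, symmDiff_symmDiff_cancel_left]
  · rintro (h | ⟨d, hd⟩)
    · exact ⟨x, h, by simp [dist_self]⟩
    · exact ⟨_, hd, (dist_symmDiff_singleton x d).le⟩

lemma mem_nbhd_one' : x ∈ nbhd 1 A ↔ x ∈ A ∨ ∃ d, insert d x ∈ A ∨ x.erase d ∈ A := by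
  rw [mem_nbhd_one]
  refine or_congr_right' fun hx ↦ exists_congr fun d ↦ ?_
  by_cases hd : d ∈ x
  · have : symmDiff x {d} = x.erase d := by ext; simp [Finset.mem_symmDiff]; grind
    rw [this, Finset.insert_eq_of_mem hd]
    tauto
  · have : symmDiff x {d} = insert d x := by ext; simp [Finset.mem_symmDiff]; grind
    rw [this, Finset.erase_eq_of_notMem hd]
    tauto

/-! ### Isometries -/

lemma nbhd_image {φ : Equiv.Perm (Finset (Fin n))} (hφ : ∀ x y, dist (φ x) (φ y) = dist x y)
    (t : ℕ) (A : Finset (Finset (Fin n))) : nbhd t (A.image φ) = (nbhd t A).image φ := by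
  ext x
  obtain ⟨x, rfl⟩ := φ.surjective x
  simp [mem_nbhd, hφ]

lemma image_compl (φ : Equiv.Perm (Finset (Fin n))) (A : Finset (Finset (Fin n))) :
    (A.image φ)ᶜ = Aᶜ.image φ := by
  ext x
  obtain ⟨x, rfl⟩ := φ.surjective x
  simp

lemma Isomorphic.symm (h : Isomorphic A B) : Isomorphic B A := by
  obtain ⟨φ, hφ, rfl⟩ := h
  refine ⟨φ.symm, fun x y ↦ by rw [← hφ]; simp, ?_⟩
  ext x
  simp [Finset.mem_image]

lemma Isomorphic.trans {C : Finset (Finset (Fin n))} (h : Isomorphic A B) (h' : Isomorphic B C) :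
    Isomorphic A C := by
  obtain ⟨φ, hφ, rfl⟩ := h
  obtain ⟨ψ, hψ, rfl⟩ := h'
  exact ⟨φ.trans ψ, fun x y ↦ by simp [hφ, hψ], by simp [Finset.image_image, Function.comp_def]⟩

lemma Isomorphic.compl (h : Isomorphic A B) : Isomorphic Aᶜ Bᶜ := by
  obtain ⟨φ, hφ, rfl⟩ := h
  exact ⟨φ, hφ, (image_compl φ A).symm⟩

lemma Isomorphic.card_eq (h : Isomorphic A B) : A.card = B.card := by
  obtain ⟨φ, hφ, rfl⟩ := h
  rw [Finset.card_image_of_injective _ φ.injective]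

lemma Isomorphic.nbhd (h : Isomorphic A B) (t : ℕ) : Isomorphic (nbhd t A) (nbhd t B) := by
  obtain ⟨φ, hφ, rfl⟩ := h
  exact ⟨φ, hφ, (nbhd_image hφ t A).symm⟩

lemma Isomorphic.minimalNbhds (h : Isomorphic A B) (hB : MinimalNbhds B) : MinimalNbhds A :=
  fun t ht C hC ↦ (h.nbhd t).card_eq.trans_le (hB t ht C (hC.trans h.card_eq))

lemma Isomorphic.extremal (h : Isomorphic A B) (hB : Extremal B) : Extremal A :=
  ⟨h.minimalNbhds hB.1, h.compl.minimalNbhds hB.2⟩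

lemma isomorphic_image_symmDiff (A : Finset (Finset (Fin n))) (x : Finset (Fin n)) :
    Isomorphic A (A.image (symmDiff x)) := by
  refine ⟨⟨symmDiff x, symmDiff x, symmDiff_symmDiff_cancel_left x,
    symmDiff_symmDiff_cancel_left x⟩, fun y z ↦ ?_, rfl⟩
  simp only [dist, Equiv.coe_fn_mk]
  rw [symmDiff_symmDiff_symmDiff_comm, symmDiff_self, bot_symmDiff]

lemma isomorphic_image_map (A : Finset (Finset (Fin n))) (σ : Equiv.Perm (Fin n)) :
    Isomorphic A (A.image (Finset.image σ)) := by
  refine ⟨σ.finsetCongr, fun y z ↦ ?_, ?_⟩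
  · simp only [dist, Equiv.finsetCongr_apply]
    rw [← Finset.card_map σ.toEmbedding (s := symmDiff y z)]
    congr 1
    ext a
    simp [Finset.mem_symmDiff]
  · refine Finset.image_congr fun y _ ↦ ?_
    simp [Finset.map_eq_image]

end Hypercube

namespace Hypercube

variable {n : ℕ} {A B : Finset (Finset (Fin n))} {x y z U V S : Finset (Fin n)} {s t : ℕ}

/-! ### Compressions and the vertex-isoperimetric inequality -/

lemma union_sdiff_mem_of_isCompressed (h : UV.IsCompressed U V A) (hS : S ∈ A) (hV : V ⊆ S)
    (hU : Disjoint U S) : (S ∪ U) \ V ∈ A := by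
  have := UV.compress_mem_compression (u := U) (v := V) hS
  rwa [h.eq, UV.compress_of_disjoint_of_le hU hV] at this

/-- Undoing the move at one coordinate d of U ∪ V is the same as compressing S with a smaller pair,
up to one further coordinate e. -/
lemma symmDiff_mem_nbhd_one (hUV : Disjoint U V)
    (hU : ∀ d ∈ U, UV.IsCompressed (U.erase d) V A ∨
      ∃ e ∈ V, UV.IsCompressed (U.erase d) (V.erase e) A)
    (hV : ∀ d ∈ V, UV.IsCompressed U (V.erase d) A ∨
      ∃ e ∈ U, UV.IsCompressed (U.erase e) (V.erase d) A)
    {d : Fin n} (hd : d ∈ U ∪ V) (hS : S ∈ A) (hVS : V ⊆ S) (hUS : Disjoint U S) :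
    symmDiff ((S ∪ U) \ V) {d} ∈ nbhd 1 A := by
  rw [mem_nbhd_one']
  rw [Finset.disjoint_left] at hUV hUS
  rcases Finset.mem_union.1 hd with hd | hd
  · rcases hU d hd with h | ⟨e, he, h⟩
    · have := union_sdiff_mem_of_isCompressed h hS hVS
        (by rw [Finset.disjoint_left]; grind)
      left
      convert! this using 1
      ext a; simp only [Finset.mem_symmDiff, Finset.mem_singleton]; grind
    · have := union_sdiff_mem_of_isCompressed h hS (by grind)
        (by rw [Finset.disjoint_left]; grind)
      right
      refine ⟨e, Or.inl ?_⟩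
      convert! this using 1
      ext a; simp only [Finset.mem_symmDiff, Finset.mem_singleton, Finset.mem_insert]; grind
  · rcases hV d hd with h | ⟨e, he, h⟩
    · have := union_sdiff_mem_of_isCompressed h hS (by grind)
        (by rw [Finset.disjoint_left]; grind)
      left
      convert! this using 1
      ext a; simp only [Finset.mem_symmDiff, Finset.mem_singleton]; grind
    · have := union_sdiff_mem_of_isCompressed h hS (by grind)
        (by rw [Finset.disjoint_left]; grind)
      right
      refine ⟨e, Or.inr ?_⟩
      convert! this using 1
      ext a; simp only [Finset.mem_symmDiff, Finset.mem_singleton, Finset.mem_erase]; grind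

/-- Here the neighbour of S at d already carries the effect of the move at d, so a smaller pair
completes the compression, up to one coordinate e. -/
lemma union_sdiff_mem_nbhd_one (hUV : Disjoint U V)
    (hU : ∀ d ∈ U, UV.IsCompressed (U.erase d) V A ∨
      ∃ e ∈ V, UV.IsCompressed (U.erase d) (V.erase e) A)
    (hV : ∀ d ∈ V, UV.IsCompressed U (V.erase d) A ∨
      ∃ e ∈ U, UV.IsCompressed (U.erase e) (V.erase d) A)
    {d : Fin n} (hd : d ∈ U ∪ V) (hS : symmDiff S {d} ∈ A) (hVS : V ⊆ S) (hUS : Disjoint U S) :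
    (S ∪ U) \ V ∈ nbhd 1 A := by
  rw [mem_nbhd_one']
  rw [Finset.disjoint_left] at hUV hUS
  rcases Finset.mem_union.1 hd with hd | hd
  · have hS' : insert d S ∈ A := by
      convert! hS using 1
      ext a; simp only [Finset.mem_symmDiff, Finset.mem_singleton]; grind
    rcases hU d hd with h | ⟨e, he, h⟩
    · have := union_sdiff_mem_of_isCompressed h hS' (by grind)
        (by rw [Finset.disjoint_left]; grind)
      left
      convert! this using 1
      ext a; grind
    · have := union_sdiff_mem_of_isCompressed h hS' (by grind)
        (by rw [Finset.disjoint_left]; grind)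
      right
      refine ⟨e, Or.inl ?_⟩
      convert! this using 1
      ext a; grind
  · have hS' : S.erase d ∈ A := by
      convert! hS using 1
      ext a; simp only [Finset.mem_symmDiff, Finset.mem_singleton]; grind
    rcases hV d hd with h | ⟨e, he, h⟩
    · have := union_sdiff_mem_of_isCompressed h hS' (by grind)
        (by rw [Finset.disjoint_left]; grind)
      left
      convert! this using 1
      ext a; grind
    · have := union_sdiff_mem_of_isCompressed h hS' (by grind)
        (by rw [Finset.disjoint_left]; grind)
      right
      refine ⟨e, Or.inr ?_⟩
      convert! this using 1
      ext a; grind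

lemma compress_symmDiff_singleton {d : Fin n} (hd : d ∉ U ∪ V) (S : Finset (Fin n)) :
    UV.compress U V (symmDiff S {d}) = symmDiff (UV.compress U V S) {d} := by
  have h1 : Disjoint U (symmDiff S {d}) ↔ Disjoint U S := by
    simp only [Finset.disjoint_left, Finset.mem_symmDiff, Finset.mem_singleton]; grind
  have h2 : V ⊆ symmDiff S {d} ↔ V ⊆ S := by
    simp only [Finset.subset_iff, Finset.mem_symmDiff, Finset.mem_singleton]; grind
  simp only [UV.compress, h1, h2]
  split_ifs
  · ext a; grind [Finset.mem_symmDiff]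
  · rfl

/-- Compressing does not enlarge the neighbourhood of a family that is already compressed with
respect to suitable smaller pairs. -/
lemma nbhd_one_compression_subset (hUV : Disjoint U V)
    (hU : ∀ d ∈ U, UV.IsCompressed (U.erase d) V A ∨
      ∃ e ∈ V, UV.IsCompressed (U.erase d) (V.erase e) A)
    (hV : ∀ d ∈ V, UV.IsCompressed U (V.erase d) A ∨
      ∃ e ∈ U, UV.IsCompressed (U.erase e) (V.erase d) A) :
    nbhd 1 (𝓒 U V A) ⊆ 𝓒 U V (nbhd 1 A) := by
  have fixed : ∀ {T}, UV.compress U V T ∈ nbhd 1 A → T ∈ nbhd 1 A → T ∈ 𝓒 U V (nbhd 1 A) :=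
    fun h h' ↦ UV.mem_compression.2 (Or.inl ⟨h', h⟩)
  have step : ∀ {T : Finset (Fin n)} (d : Fin n), T ∈ A → symmDiff T {d} ∈ nbhd 1 A :=
    fun d h ↦ mem_nbhd_one.2 (Or.inr ⟨d, by rwa [symmDiff_symmDiff_cancel_right]⟩)
  intro T hT
  rcases mem_nbhd_one.1 hT with hT | ⟨d, hT⟩
  · rcases UV.mem_compression.1 hT with ⟨h, h'⟩ | ⟨h, b, hb, rfl⟩
    · exact fixed (subset_nbhd h') (subset_nbhd h)
    · exact UV.compress_mem_compression (subset_nbhd hb)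
  obtain ⟨S, rfl⟩ : ∃ S, T = symmDiff S {d} :=
    ⟨symmDiff T {d}, (symmDiff_symmDiff_cancel_right _ _).symm⟩
  rw [symmDiff_symmDiff_cancel_right] at hT
  by_cases hd : d ∈ U ∪ V
  · rcases UV.mem_compression.1 hT with ⟨h, h'⟩ | ⟨h, b, hb, rfl⟩
    · refine fixed ?_ (step d h)
      rw [UV.compress]
      split_ifs with hp
      · exact union_sdiff_mem_nbhd_one hUV hU hV hd
          (by rwa [symmDiff_symmDiff_cancel_right]) hp.2 hp.1
      · exact step d h
    · have hp : Disjoint U b ∧ V ≤ b := by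
        by_contra hp
        rw [UV.compress, if_neg hp] at h
        exact h hb
      rw [UV.compress_of_disjoint_of_le hp.1 hp.2] at h ⊢
      have key := symmDiff_mem_nbhd_one hUV hU hV hd hb hp.2 hp.1
      refine fixed ?_ key
      rw [UV.compress]
      split_ifs with hq
      -- The compressed set contains U and misses V, and its toggle at d does the opposite; hence U
      -- ∪ V = {d}, and compressing twice amounts to toggling d.
      · rw [mem_nbhd_one]
        right
        refine ⟨d, ?_⟩
        convert! hb using 1
        have h1 := hp.1
        have h2 := hq.1
        have h3 := hp.2
        have h4 := hq.2
        rw [Finset.disjoint_left] at h1 h2 hUV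
        simp only [Finset.subset_iff, Finset.mem_symmDiff,
          Finset.mem_singleton, Finset.sup_eq_union, Finset.mem_union, Finset.mem_sdiff] at h2 h3 h4 hd
        ext a
        simp only [Finset.mem_symmDiff, Finset.mem_singleton, Finset.sup_eq_union,
          Finset.mem_union, Finset.mem_sdiff]
        have := @h1 a
        have := @h2 a
        have := @h3 a
        have := @h4 a
        have := @hUV a
        have := @hUV d
        by_cases a = d <;> grind
      · exact key
  · rcases UV.mem_compression.1 hT with ⟨h, h'⟩ | ⟨h, b, hb, rfl⟩
    · exact fixed (by rw [compress_symmDiff_singleton hd]; exact step d h') (step d h)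
    · rw [← compress_symmDiff_singleton hd]
      exact UV.compress_mem_compression (step d hb)

end Hypercube

/-! ### The order by decreasing size and colex, and Harper's inequality for its segments -/

namespace Hypercube

variable {n : ℕ} {A B H : Finset (Finset (Fin n))} {x y z U V S T R : Finset (Fin n)} {s t : ℕ}

/-- Larger sets come first; sets of the same size are compared in the colexicographic order. -/
def Precedes (S T : Finset (Fin n)) : Prop :=
  T.card < S.card ∨ S.card = T.card ∧ toColex S < toColex T

lemma Precedes.trans (h : Precedes S T) (h' : Precedes T R) : Precedes S R := by
  rcases h with h | ⟨h, hl⟩ <;> rcases h' with h' | ⟨h', hl'⟩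
  · exact Or.inl (h'.trans h)
  · exact Or.inl (h' ▸ h)
  · exact Or.inl (h ▸ h')
  · exact Or.inr ⟨h.trans h', hl.trans hl'⟩

lemma Precedes.irrefl (S : Finset (Fin n)) : ¬ Precedes S S := by simp [Precedes]

lemma precedes_trichotomous (S T : Finset (Fin n)) : Precedes S T ∨ S = T ∨ Precedes T S := by
  unfold Precedes
  rcases lt_trichotomy S.card T.card with h | h | h
  · simp [h]
  · rcases lt_trichotomy (toColex S) (toColex T) with h' | h' | h'
    · simp [h, h']
    · exact Or.inr (Or.inl (toColex.injective h'))
    · simp [h, h']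
  · simp [h]

lemma precedes_sdiff_sdiff (h : Precedes S T) : Precedes (S \ T) (T \ S) := by
  have h1 := Finset.card_sdiff_add_card_inter S T
  have h2 := Finset.card_sdiff_add_card_inter T S
  rw [Finset.inter_comm T S] at h2
  rcases h with h | ⟨h, hl⟩
  · left; omega
  · exact Or.inr ⟨by omega, Finset.Colex.toColex_sdiff_lt_toColex_sdiff'.2 hl⟩

lemma precedes_compress (hUV : Disjoint U V) (h : Precedes U V) (hS : UV.compress U V S ≠ S) :
    Precedes (UV.compress U V S) S := by
  rw [UV.compress, ite_ne_right_iff] at hS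
  obtain ⟨⟨hU, hV⟩, -⟩ := hS
  rw [UV.compress_of_disjoint_of_le hU hV]
  have e1 : ((S ∪ U) \ V) \ U = S \ V := by
    rw [Finset.disjoint_left] at hUV hU; ext a; grind
  have c1 : ((S ∪ U) \ V).card = (S \ V).card + U.card := by
    rw [← e1, Finset.card_sdiff_add_card_eq_card]
    rw [Finset.disjoint_left] at hUV; intro a; grind
  have c2 : (S \ V).card + V.card = S.card := Finset.card_sdiff_add_card_eq_card hV
  rw [Precedes, Finset.sup_eq_union]
  rcases h with h | ⟨h, hl⟩
  · left; omega
  · refine Or.inr ⟨by omega, ?_⟩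
    -- Removing the common part S \ V reduces the comparison to that of U with V.
    rw [← Finset.Colex.toColex_sdiff_lt_toColex_sdiff (u := S \ V)]
    · convert! hl using 2
      · rw [Finset.disjoint_left] at hUV hU; ext a; grind
      · ext a; grind
    · rw [← e1]; exact Finset.sdiff_subset
    · exact Finset.sdiff_subset

/-- Families that are closed under taking predecessors. -/
def IsSegment (A : Finset (Finset (Fin n))) : Prop :=
  ∀ ⦃S T⦄, T ∈ A → Precedes S T → S ∈ A

lemma IsSegment.subset_of_card_le (hA : IsSegment A) (hB : IsSegment B) (h : A.card ≤ B.card) :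
    A ⊆ B := by
  by_contra hAB
  obtain ⟨x, hxA, hxB⟩ := Finset.not_subset.1 hAB
  refine (Finset.card_lt_card (Finset.ssubset_iff_of_subset ?_ |>.2 ⟨x, hxA, hxB⟩)).not_ge h
  intro y hy
  rcases precedes_trichotomous x y with hxy | rfl | hxy
  · exact absurd (hB hy hxy) hxB
  · exact absurd hy hxB
  · exact hA hxA hxy

/-- If S precedes T, the compression for the pair (S \ T, T \ S) sends T to S. -/
lemma isSegment_of_isCompressed
    (h : ∀ U V, Disjoint U V → Precedes U V → UV.IsCompressed U V A) : IsSegment A := by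
  intro S T hT hST
  have := UV.compress_mem_compression (u := S \ T) (v := T \ S) hT
  rwa [(h _ _ (disjoint_sdiff_sdiff) (precedes_sdiff_sdiff hST)).eq,
    UV.compress_sdiff_sdiff] at this

open Classical in
/-- The number of predecessors of a set. -/
noncomputable def rank (S : Finset (Fin n)) : ℕ :=
  (Finset.univ.filter fun T ↦ Precedes T S).card

lemma rank_lt_rank (h : Precedes S T) : rank S < rank T := by
  classical
  refine Finset.card_lt_card (Finset.ssubset_iff_of_subset ?_ |>.2 ⟨S, ?_, ?_⟩)
  · intro R hR
    simp only [Finset.mem_filter, Finset.mem_univ, true_and] at hR ⊢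
    exact hR.trans h
  · simpa using h
  · simpa using Precedes.irrefl S

/-- The total rank is the potential that drives the compression argument: every set that moves is
replaced by a predecessor. -/
lemma sum_rank_compression_lt (hUV : Disjoint U V) (h : Precedes U V)
    (hA : ¬ UV.IsCompressed U V A) : ∑ S ∈ 𝓒 U V A, rank S < ∑ S ∈ A, rank S := by
  rw [UV.IsCompressed, UV.compression] at hA
  rw [UV.compression]
  have uA : {S ∈ A | UV.compress U V S ∈ A} ∪ {S ∈ A | UV.compress U V S ∉ A} = A :=
    Finset.filter_union_filter_not_eq _ _
  have ne₂ : {S ∈ A | UV.compress U V S ∉ A}.Nonempty := by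
    contrapose! hA
    rw [Finset.filter_image, hA, Finset.image_empty, Finset.union_empty]
    rwa [hA, Finset.union_empty] at uA
  rw [Finset.sum_union UV.compress_disjoint]
  conv_rhs => rw [← uA]
  rw [Finset.sum_union (Finset.disjoint_filter_filter_not _ _ _), add_lt_add_iff_left,
    Finset.filter_image, Finset.sum_image UV.compress_injOn]
  refine Finset.sum_lt_sum_of_nonempty ne₂ fun S hS ↦ rank_lt_rank (precedes_compress hUV h ?_)
  rw [Finset.mem_filter] at hS
  exact fun h ↦ hS.2 (h.symm ▸ hS.1)

/-- A pair obtained from a minimal useful pair by removing elements is harmless. -/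
lemma card_nbhd_one_compression_le (hUV : Disjoint U V) (h : Precedes U V)
    (hmin : ∀ U' V', Disjoint U' V' → Precedes U' V' → U'.card + V'.card < U.card + V.card →
      UV.IsCompressed U' V' A) : (nbhd 1 (𝓒 U V A)).card ≤ (nbhd 1 A).card := by
  refine (Finset.card_le_card (nbhd_one_compression_subset hUV ?_ ?_)).trans_eq
    (UV.card_compression _ _ _)
  · intro d hd
    have hUd := Finset.card_erase_add_one hd
    have dis : ∀ e, Disjoint (U.erase d) (V.erase e) := fun e ↦
      hUV.mono (Finset.erase_subset _ _) (Finset.erase_subset _ _)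
    rcases V.eq_empty_or_nonempty with rfl | hV
    · left
      rcases (U.erase d).eq_empty_or_nonempty with h0 | h0
      · rw [h0]; exact UV.isCompressed_self _ _
      · exact hmin _ _ (by simp) (Or.inl (by simpa using h0)) (by omega)
    · right
      -- Dropping the least element of V weakens V the least in colex, so U still comes no later
      -- whichever d it loses.
      refine ⟨V.min' hV, V.min'_mem hV, ?_⟩
      have hVe := Finset.card_erase_add_one (V.min'_mem hV)
      rcases h with h | ⟨h, hl⟩
      · exact hmin _ _ (dis _) (Or.inl (by omega)) (by omega)
      · rcases (U.erase d).eq_empty_or_nonempty with h0 | h0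
        · have : V.erase (V.min' hV) = ∅ := by
            rw [← Finset.card_eq_zero]; rw [← Finset.card_eq_zero] at h0; omega
          rw [h0, this]; exact UV.isCompressed_self _ _
        · refine hmin _ _ (dis _) (Or.inr ⟨by omega, ?_⟩) (by omega)
          refine (Finset.Colex.erase_le_erase_min' hl.le h.le hd).lt_of_ne fun heq ↦ ?_
          rw [toColex_inj] at heq
          obtain ⟨a, ha⟩ := h0
          exact Finset.disjoint_left.1 hUV (Finset.mem_of_mem_erase ha)
            (Finset.mem_of_mem_erase (heq ▸ ha))
  · intro d hd
    have hVd := Finset.card_erase_add_one hd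
    rcases h with h | ⟨h, hl⟩
    · right
      obtain ⟨e, he⟩ : U.Nonempty := Finset.card_pos.1 (by omega)
      have hUe := Finset.card_erase_add_one he
      exact ⟨e, he, hmin _ _ (hUV.mono (Finset.erase_subset _ _) (Finset.erase_subset _ _))
        (Or.inl (by omega)) (by omega)⟩
    -- With |U| = |V|, shrinking V alone makes U the larger set, which therefore precedes.
    · left
      exact hmin _ _ (hUV.mono_right (Finset.erase_subset _ _)) (Or.inl (by omega)) (by omega)

/-- Take a competitor B of least total rank. If it were not fully compressed, a violating pair with
|U| + |V| minimal would lower the rank without enlarging the neighbourhood. -/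
lemma exists_isSegment (A : Finset (Finset (Fin n))) :
    ∃ B : Finset (Finset (Fin n)), B.card = A.card ∧ (nbhd 1 B).card ≤ (nbhd 1 A).card ∧ IsSegment B := by
  classical
  obtain ⟨B, hB, hBmin⟩ := Finset.exists_min_image
    (Finset.univ.filter fun B : Finset (Finset (Fin n)) ↦
      B.card = A.card ∧ (nbhd 1 B).card ≤ (nbhd 1 A).card) (fun B ↦ ∑ S ∈ B, rank S) ⟨A, by simp⟩
  simp only [Finset.mem_filter, Finset.mem_univ, true_and] at hB hBmin
  refine ⟨B, hB.1, hB.2, isSegment_of_isCompressed ?_⟩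
  by_contra! hne
  obtain ⟨U₀, V₀, h₀⟩ := hne
  obtain ⟨⟨U, V⟩, hUV, hmin⟩ := Finset.exists_min_image
    (Finset.univ.filter fun p : Finset (Fin n) × Finset (Fin n) ↦
      Disjoint p.1 p.2 ∧ Precedes p.1 p.2 ∧ ¬ UV.IsCompressed p.1 p.2 B)
    (fun p ↦ p.1.card + p.2.card) ⟨(U₀, V₀), by simpa using h₀⟩
  simp only [Finset.mem_filter, Finset.mem_univ, true_and, Prod.forall] at hUV hmin
  have key := card_nbhd_one_compression_le hUV.1 hUV.2.1 (A := B) fun U' V' h1 h2 h3 ↦ by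
    by_contra h4
    exact h3.not_ge (hmin U' V' ⟨h1, h2, h4⟩)
  exact (sum_rank_compression_lt hUV.1 hUV.2.1 hUV.2.2).not_ge
    (hBmin _ ⟨(UV.card_compression _ _ _).trans hB.1, key.trans hB.2⟩)

/-- Allowing |H| ≤ |A| rather than equality is what lets the inequality be iterated: after one step
the two sides may differ in size. -/
lemma IsSegment.card_nbhd_one_le (hH : IsSegment H) (h : H.card ≤ A.card) :
    (nbhd 1 H).card ≤ (nbhd 1 A).card := by
  obtain ⟨B, hBA, hB, hBs⟩ := exists_isSegment A
  exact (Finset.card_le_card (nbhd_mono (hH.subset_of_card_le hBs (h.trans_eq hBA.symm)))).trans hB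

end Hypercube

namespace Hypercube

variable {n : ℕ} {A B H E 𝒜 : Finset (Finset (Fin n))} {x y z U V S T R : Finset (Fin n)}
  {s t : ℕ} {i : Fin n}

/-! ### Section sets -/

lemma nbhd_succ' (t : ℕ) (A : Finset (Finset (Fin n))) : nbhd (t + 1) A = nbhd t (nbhd 1 A) := by
  induction t with
  | zero => simp [nbhd_zero]
  | succ t ih => rw [nbhd_succ, ih, ← nbhd_succ]

lemma mem_layersGE : x ∈ layersGE n s ↔ s ≤ x.card := by simp [layersGE]

lemma mem_sectionSet : x ∈ sectionSet s E i ↔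
    s + 1 ≤ x.card ∨ i ∉ x ∧ (x ∈ E ∨ insert i x ∈ E) := by
  simp only [sectionSet, Finset.mem_union, mem_layersGE, Finset.mem_nonMemberSubfamily,
    Finset.mem_memberSubfamily]
  tauto

/-- The three pieces live on sizes ≥ s + 1, s and s - 1, and the two sections together count E. -/
lemma card_sectionSet (hE : (E : Set (Finset (Fin n))).Sized s) (i : Fin n) :
    (sectionSet s E i).card = (layersGE n (s + 1)).card + E.card := by
  rw [sectionSet, Finset.card_union_of_disjoint, Finset.card_union_of_disjoint, add_assoc,
    add_comm (E.nonMemberSubfamily i).card, Finset.card_memberSubfamily_add_card_nonMemberSubfamily]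
  · rw [Finset.disjoint_left]
    intro x hx hx'
    rw [mem_layersGE] at hx
    have := hE (Finset.mem_nonMemberSubfamily.1 hx').1
    omega
  · rw [Finset.disjoint_left]
    intro x hx hx'
    have h2 := Finset.mem_memberSubfamily.1 hx'
    have h3 := hE h2.1
    rw [Finset.card_insert_of_notMem h2.2] at h3
    rcases Finset.mem_union.1 hx with hx | hx
    · rw [mem_layersGE] at hx
      omega
    · have := hE (Finset.mem_nonMemberSubfamily.1 hx).1
      omega

lemma card_layersGE_union (hE : (E : Set (Finset (Fin n))).Sized s) :
    (layersGE n (s + 1) ∪ E).card = (layersGE n (s + 1)).card + E.card := by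
  rw [Finset.card_union_of_disjoint]
  rw [Finset.disjoint_left]
  intro x hx hx'
  rw [mem_layersGE] at hx
  have := hE hx'
  omega

lemma exists_notMem_of_card_lt (h : x.card < n) : ∃ d, d ∉ x := by
  by_contra! hx
  rw [Finset.eq_univ_iff_forall.2 hx] at h
  simp at h

lemma univ_mem_of_sized (hE : (E : Set (Finset (Fin n))).Sized s) (hne : E.Nonempty)
    (hs : n ≤ s) : Finset.univ ∈ E := by
  obtain ⟨y, hy⟩ := hne
  have h1 := hE hy
  have h2 : y = Finset.univ := by
    rw [← Finset.card_eq_iff_eq_univ, Fintype.card_fin]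
    have := Finset.card_le_univ y
    rw [Fintype.card_fin] at this
    omega
  rwa [← h2]

/-- On sections, (∂E)_{i,1} = ∂(E_{i,1}) ∪ E_{i,0} and (∂E)_{i,0} = ∂(E_{i,0}): exactly what
survives below the full layers after one step. `hne` excludes E = ∅ with s + 1 = n, where the left
side is empty but the right side contains X. -/
lemma nbhd_one_sectionSet (hE : (E : Set (Finset (Fin n))).Sized (s + 1))
    (hne : s + 1 < n ∨ E.Nonempty) (i : Fin n) :
    nbhd 1 (sectionSet (s + 1) E i) = sectionSet s (∂ E) i := by
  ext x
  rw [mem_nbhd_one', mem_sectionSet]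
  simp only [mem_sectionSet, Finset.mem_shadow_iff_insert_mem]
  constructor
  · rintro ((h | ⟨hi, h | h⟩) | ⟨d, (h | ⟨hi, h | h⟩) | (h | ⟨hi, h | h⟩)⟩)
    · left; omega
    · left; exact (hE h).ge
    · exact Or.inr ⟨hi, Or.inl ⟨i, hi, h⟩⟩
    · have := Finset.card_insert_le d x
      left; omega
    · by_cases hd : d ∈ x
      · rw [Finset.insert_eq_of_mem hd] at h
        left; exact (hE h).ge
      · exact Or.inr ⟨fun h' ↦ hi (Finset.mem_insert_of_mem h'), Or.inl ⟨d, hd, h⟩⟩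
    · by_cases hd : d ∈ x
      · rw [Finset.insert_eq_of_mem hd] at h hi
        exact Or.inr ⟨hi, Or.inl ⟨i, hi, h⟩⟩
      · rw [Finset.mem_insert, not_or] at hi
        refine Or.inr ⟨hi.2, Or.inr ⟨d, ?_, ?_⟩⟩
        · rw [Finset.mem_insert, not_or]
          exact ⟨Ne.symm hi.1, hd⟩
        · rwa [Finset.insert_comm]
    · have := Finset.card_erase_le (s := x) (a := d)
      left; omega
    · have := Finset.card_erase_le (s := x) (a := d)
      have := hE h
      left; omega
    · have h1 := hE h
      rw [Finset.card_insert_of_notMem hi] at h1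
      by_cases hd : d ∈ x
      · have := Finset.card_erase_add_one hd
        left; omega
      · rw [Finset.erase_eq_of_notMem hd] at h hi
        exact Or.inr ⟨hi, Or.inl ⟨i, hi, h⟩⟩
  · rintro (h | ⟨hi, ⟨d, hd, h⟩ | ⟨d, hd, h⟩⟩)
    · by_cases h2 : s + 1 + 1 ≤ x.card
      · exact Or.inl (Or.inl h2)
      by_cases h3 : s + 1 < n
      · obtain ⟨d, hd⟩ := exists_notMem_of_card_lt (x := x) (by omega)
        refine Or.inr ⟨d, Or.inl (Or.inl ?_)⟩
        rw [Finset.card_insert_of_notMem hd]; omega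
      · have hu := univ_mem_of_sized hE (hne.resolve_left h3) (by omega)
        have hxu : x = Finset.univ := by
          rw [← Finset.card_eq_iff_eq_univ, Fintype.card_fin]
          have := Finset.card_le_univ x
          rw [Fintype.card_fin] at this
          omega
        refine Or.inr ⟨i, Or.inr (Or.inr ⟨by simp, Or.inr ?_⟩)⟩
        rw [hxu, Finset.insert_erase (Finset.mem_univ _)]
        exact hu
    · by_cases hdi : d = i
      · subst hdi
        exact Or.inl (Or.inr ⟨hi, Or.inr h⟩)
      · refine Or.inr ⟨d, Or.inl (Or.inr ⟨?_, Or.inl h⟩)⟩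
        rw [Finset.mem_insert, not_or]
        exact ⟨Ne.symm hdi, hi⟩
    · rw [Finset.mem_insert, not_or] at hd
      refine Or.inr ⟨d, Or.inl (Or.inr ⟨?_, Or.inr ?_⟩)⟩
      · rw [Finset.mem_insert, not_or]
        exact ⟨Ne.symm hd.1, hi⟩
      · rwa [Finset.insert_comm]

lemma nbhd_one_layersGE_union (hE : (E : Set (Finset (Fin n))).Sized (s + 1))
    (hne : s + 1 < n ∨ E.Nonempty) :
    nbhd 1 (layersGE n (s + 1 + 1) ∪ E) = layersGE n (s + 1) ∪ ∂ E := by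
  ext x
  rw [mem_nbhd_one']
  simp only [Finset.mem_union, mem_layersGE, Finset.mem_shadow_iff_insert_mem]
  constructor
  · rintro ((h | h) | ⟨d, (h | h) | (h | h)⟩)
    · left; omega
    · left; exact (hE h).ge
    · have := Finset.card_insert_le d x
      left; omega
    · by_cases hd : d ∈ x
      · rw [Finset.insert_eq_of_mem hd] at h
        left; exact (hE h).ge
      · exact Or.inr ⟨d, hd, h⟩
    · have := Finset.card_erase_le (s := x) (a := d)
      left; omega
    · have := Finset.card_erase_le (s := x) (a := d)
      have := hE h
      left; omega
  · rintro (h | ⟨d, hd, h⟩)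
    · by_cases h2 : s + 1 + 1 ≤ x.card
      · exact Or.inl (Or.inl h2)
      by_cases h3 : s + 1 < n
      · obtain ⟨d, hd⟩ := exists_notMem_of_card_lt (x := x) (by omega)
        refine Or.inr ⟨d, Or.inl (Or.inl ?_)⟩
        rw [Finset.card_insert_of_notMem hd]; omega
      · have hu := univ_mem_of_sized hE (hne.resolve_left h3) (by omega)
        have hxu : x = Finset.univ := by
          rw [← Finset.card_eq_iff_eq_univ, Fintype.card_fin]
          have := Finset.card_le_univ x
          rw [Fintype.card_fin] at this
          omega
        exact Or.inl (Or.inr (hxu ▸ hu))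
    · exact Or.inr ⟨d, Or.inl (Or.inr h)⟩

lemma nbhd_one_eq_univ (i : Fin n) (h : layersGE n 1 ⊆ A) : nbhd 1 A = Finset.univ := by
  refine Finset.eq_univ_iff_forall.2 fun x ↦ mem_nbhd_one'.2 ?_
  obtain rfl | hx := x.eq_empty_or_nonempty
  · exact Or.inr ⟨i, Or.inl (h (mem_layersGE.2 (by simp)))⟩
  · exact Or.inl (h (mem_layersGE.2 hx.card_pos))

lemma shadow_nonempty (hE : (E : Set (Finset (Fin n))).Sized (s + 1)) (hne : E.Nonempty) :
    (∂ E).Nonempty := by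
  obtain ⟨y, hy⟩ := hne
  have := hE hy
  obtain ⟨a, ha⟩ : y.Nonempty := Finset.card_pos.1 (by omega)
  exact ⟨_, Finset.erase_mem_shadow hy ha⟩

lemma nbhd_sectionSet (hE : (E : Set (Finset (Fin n))).Sized (s + t))
    (hne : s + t < n ∨ E.Nonempty) (i : Fin n) :
    nbhd t (sectionSet (s + t) E i) = sectionSet s (∂^[t] E) i := by
  induction t generalizing E with
  | zero => simp [nbhd_zero]
  | succ t ih =>
    rw [nbhd_succ', ← add_assoc, nbhd_one_sectionSet (s := s + t) hE hne, ih, Function.iterate_succ_apply]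
    · exact hE.shadow
    · exact hne.imp (fun h ↦ by omega) (shadow_nonempty hE)

lemma isSegment_layersGE_union (h𝒜 : Finset.Colex.IsInitSeg 𝒜 s) :
    IsSegment (layersGE n (s + 1) ∪ 𝒜) := by
  intro S T hT hST
  rw [Finset.mem_union, mem_layersGE] at hT ⊢
  rcases hT with hT | hT
  · rcases hST with h | h
    · left; omega
    · left; omega
  · have := h𝒜.1 hT
    rcases hST with h | h
    · left; omega
    · exact Or.inr (h𝒜.2 hT ⟨h.2, h.1.trans this⟩)

/-- The segment X^(≥s+1) ∪ 𝒜 and the section set have equal sizes, and so do their 1-neighbourhoods;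
Harper's inequality for the former supplies the hypothesis of the next induction step, with 𝒜
replaced by its shadow. -/
lemma card_nbhd_sectionSet_le (h𝒜 : Finset.Colex.IsInitSeg 𝒜 s) (hne : s < n ∨ 𝒜.Nonempty)
    (i : Fin n) (h : (sectionSet s 𝒜 i).card ≤ B.card) (t : ℕ) :
    (nbhd t (sectionSet s 𝒜 i)).card ≤ (nbhd t B).card := by
  induction t generalizing s 𝒜 B with
  | zero => simpa [nbhd_zero] using h
  | succ t ih =>
    have hseg := isSegment_layersGE_union h𝒜
    have hcard : (layersGE n (s + 1) ∪ 𝒜).card ≤ B.card := by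
      rwa [card_layersGE_union h𝒜.1, ← card_sectionSet h𝒜.1 i]
    have key := hseg.card_nbhd_one_le hcard
    cases s with
    -- At s = 0 the segment contains every nonempty set, so one step fills the cube.
    | zero =>
      rw [nbhd_one_eq_univ i Finset.subset_union_left] at key
      have hB : nbhd 1 B = Finset.univ :=
        Finset.eq_univ_of_card _ (le_antisymm (Finset.card_le_univ _) key)
      rw [nbhd_succ' t B, hB]
      exact Finset.card_le_card ((Finset.subset_univ _).trans subset_nbhd)
    | succ s =>
      rw [nbhd_succ' t B, nbhd_succ', nbhd_one_sectionSet h𝒜.1 hne]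
      rw [nbhd_one_layersGE_union h𝒜.1 hne] at key
      have hsh : Finset.Colex.IsInitSeg (∂ 𝒜) s := h𝒜.shadow
      refine ih hsh (hne.imp (fun h ↦ by omega) (shadow_nonempty h𝒜.1)) ?_
      rwa [card_sectionSet hsh.1, ← card_layersGE_union hsh.1]

lemma minimalNbhds_sectionSet (h𝒜 : Finset.Colex.IsInitSeg 𝒜 s) (i : Fin n) :
    MinimalNbhds (sectionSet s 𝒜 i) := by
  intro t _ B hB
  by_cases hne : s < n ∨ 𝒜.Nonempty
  · exact card_nbhd_sectionSet_le h𝒜 hne i hB.ge t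
  · rw [not_or, Finset.not_nonempty_iff_eq_empty] at hne
    have : sectionSet s 𝒜 i = ∅ := by
      ext x
      have := Finset.card_le_univ x
      rw [Fintype.card_fin] at this
      simp [mem_sectionSet, hne.2]
      omega
    simp [this, nbhd_empty]

/-- The complements of the `s`-element sets that are not in `E`. -/
def coFamily (s : ℕ) (E : Finset (Finset (Fin n))) : Finset (Finset (Fin n)) :=
  Finset.univ.filter fun x ↦ xᶜ.card = s ∧ xᶜ ∉ E

lemma mem_coFamily : x ∈ coFamily s E ↔ xᶜ.card = s ∧ xᶜ ∉ E := by simp [coFamily]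

lemma card_compl_add (x : Finset (Fin n)) : xᶜ.card + x.card = n := by
  rw [Finset.card_compl_add_card, Fintype.card_fin]

lemma sized_coFamily : (coFamily s E : Set (Finset (Fin n))).Sized (n - s) := by
  intro x hx
  have h1 := (mem_coFamily.1 hx).1
  have h2 := card_compl_add x
  omega

/-- Complementing two sets keeps their symmetric difference and so reverses colex; passing to
non-members reverses it once more. -/
lemma isInitSeg_coFamily (hs : s ≤ n) (h𝒜 : Finset.Colex.IsInitSeg 𝒜 s) :
    Finset.Colex.IsInitSeg (coFamily s 𝒜) (n - s) := by
  refine ⟨sized_coFamily, fun T R hT hR ↦ ?_⟩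
  rw [mem_coFamily] at hT ⊢
  have h1 := card_compl_add R
  refine ⟨by omega, fun hR' ↦ hT.2 (h𝒜.2 hR' ⟨?_, hT.1⟩)⟩
  have h2 := Finset.Colex.toColex_lt_toColex.1 hR.1
  refine Finset.Colex.toColex_lt_toColex.2 ⟨fun h ↦ h2.1 (compl_injective h).symm, ?_⟩
  intro a ha hb
  obtain ⟨b, hb1, hb2, hb3⟩ := h2.2 (by simpa using hb) (by simpa using ha)
  exact ⟨b, by simpa using hb2, by simpa using hb1, hb3⟩

/-- The isometry complements every coordinate except i. It keeps the sets avoiding i among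
themselves and exchanges the roles of the two sections. -/
lemma isomorphic_compl_sectionSet (hs : s ≤ n) (hE : (E : Set (Finset (Fin n))).Sized s)
    (i : Fin n) :
    Isomorphic (sectionSet s E i)ᶜ (sectionSet (n - s) (coFamily s E) i) := by
  convert! isomorphic_image_symmDiff (sectionSet s E i)ᶜ ({i}ᶜ : Finset (Fin n)) using 1
  ext y
  have key : y ∈ (sectionSet s E i)ᶜ.image (symmDiff ({i}ᶜ : Finset (Fin n))) ↔
      symmDiff {i}ᶜ y ∉ sectionSet s E i := by
    rw [← Finset.mem_compl, Finset.mem_image]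
    constructor
    · rintro ⟨x, hx, rfl⟩
      rwa [symmDiff_symmDiff_cancel_left]
    · intro h
      exact ⟨_, h, symmDiff_symmDiff_cancel_left _ _⟩
  rw [key, mem_sectionSet, mem_sectionSet]
  by_cases hi : i ∈ y
  · have e : symmDiff {i}ᶜ y = (y.erase i)ᶜ := by
      ext a; simp only [Finset.mem_symmDiff, Finset.mem_compl, Finset.mem_singleton,
        Finset.mem_erase]; grind
    have h1 := card_compl_add (y.erase i)
    have h2 := Finset.card_erase_add_one hi
    rw [e]
    simp only [hi, Finset.mem_compl, Finset.mem_erase, ne_eq, not_true_eq_false, false_and,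
      not_false_eq_true, or_false]
    omega
  · have e : symmDiff {i}ᶜ y = (insert i y)ᶜ := by
      ext a; simp only [Finset.mem_symmDiff, Finset.mem_compl, Finset.mem_singleton,
        Finset.mem_insert]; grind
    have e' : insert i (insert i y)ᶜ = yᶜ := by
      ext a; simp only [Finset.mem_compl, Finset.mem_insert]; grind
    have h1 := card_compl_add (insert i y)
    have h2 := Finset.card_insert_of_notMem hi
    have h3 := card_compl_add y
    have h4 : (insert i y)ᶜ ∈ E → (insert i y)ᶜ.card = s := fun h ↦ hE h
    have h5 : yᶜ ∈ E → yᶜ.card = s := fun h ↦ hE h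
    rw [e, e', mem_coFamily, mem_coFamily]
    simp only [hi, Finset.mem_compl, Finset.mem_insert, true_or, not_true_eq_false,
      not_false_eq_true, true_and]
    by_cases h6 : (insert i y)ᶜ ∈ E
    · have := h4 h6
      -- The two sets differ in size by one, so at most one of them lies in E.
      have h7 : yᶜ ∉ E := fun h ↦ by have := h5 h; omega
      simp only [h6, h7, not_true_eq_false, not_false_eq_true, and_true, and_false, or_true,
        or_false, iff_false]
      omega
    · by_cases h7 : yᶜ ∈ E
      · have := h5 h7
        simp only [h6, h7, not_true_eq_false, not_false_eq_true, and_true, and_false, or_true,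
          false_or, iff_false]
        omega
      · simp only [h6, h7, not_false_eq_true, and_true, or_false]
        omega

lemma extremal_sectionSet (hs : s ≤ n) (h𝒜 : Finset.Colex.IsInitSeg 𝒜 s) (i : Fin n) :
    Extremal (sectionSet s 𝒜 i) :=
  ⟨minimalNbhds_sectionSet h𝒜 i, (isomorphic_compl_sectionSet hs h𝒜.1 i).minimalNbhds
    (minimalNbhds_sectionSet (isInitSeg_coFamily hs h𝒜) i)⟩

end Hypercube

namespace Hypercube

variable {n : ℕ} {A B H E 𝒜 : Finset (Finset (Fin n))} {x y U V S T R W : Finset (Fin n)}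
  {r s t j : ℕ} {i z p : Fin n}

/-! ### Uniqueness in the Kruskal-Katona theorem -/

/-- The `j`-element sets that are contained in a member of `E`. -/
def shadowLevel (j : ℕ) (E : Finset (Finset (Fin n))) : Finset (Finset (Fin n)) :=
  Finset.univ.filter fun T ↦ T.card = j ∧ ∃ S ∈ E, T ⊆ S

/-- The `j`-element sets all of whose `s`-element subsets belong to `E`. -/
def cliqueLevel (s j : ℕ) (E : Finset (Finset (Fin n))) : Finset (Finset (Fin n)) :=
  Finset.univ.filter fun T ↦ T.card = j ∧ T.powersetCard s ⊆ E

lemma mem_shadowLevel : T ∈ shadowLevel j E ↔ T.card = j ∧ ∃ S ∈ E, T ⊆ S := by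
  simp [shadowLevel]

lemma mem_cliqueLevel : T ∈ cliqueLevel s j E ↔ T.card = j ∧ T.powersetCard s ⊆ E := by
  simp [cliqueLevel]

/-- `E` consists of all `s`-element subsets of `W` and of at least one `s`-element subset of
`W ∪ {z}` containing `z`. -/
structure IsCone (s : ℕ) (W : Finset (Fin n)) (z : Fin n) (E : Finset (Finset (Fin n))) : Prop where
  notMem : z ∉ W
  powersetCard_subset : W.powersetCard s ⊆ E
  subset_powersetCard : E ⊆ (insert z W).powersetCard s
  nonempty : (E.memberSubfamily z).Nonempty

lemma exists_subset_card_eq_mem {a : Fin n} (ha : a ∈ T) (hr : 1 ≤ r) (hT : r ≤ T.card) :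
    ∃ R ⊆ T, R.card = r ∧ a ∈ R := by
  obtain ⟨R, h1, h2, h3⟩ := Finset.exists_subsuperset_card_eq
    (Finset.singleton_subset_iff.2 ha) (n := r) (by simpa using hr) hT
  exact ⟨R, h2, h3, Finset.singleton_subset_iff.1 h1⟩

namespace IsCone

lemma nonMemberSubfamily_eq (h : IsCone s W z E) :
    E.nonMemberSubfamily z = W.powersetCard s := by
  ext S
  rw [Finset.mem_nonMemberSubfamily]
  constructor
  · rintro ⟨h1, h2⟩
    have := Finset.mem_powersetCard.1 (h.subset_powersetCard h1)
    exact Finset.mem_powersetCard.2 ⟨(Finset.subset_insert_iff_of_notMem h2).1 this.1, this.2⟩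
  · intro h1
    exact ⟨h.powersetCard_subset h1, fun h2 ↦ h.notMem ((Finset.mem_powersetCard.1 h1).1 h2)⟩

lemma card_eq (h : IsCone s W z E) :
    E.card = W.card.choose s + (E.memberSubfamily z).card := by
  rw [← Finset.card_memberSubfamily_add_card_nonMemberSubfamily z E, h.nonMemberSubfamily_eq,
    Finset.card_powersetCard, add_comm]

lemma memberSubfamily_subset (h : IsCone (r + 1) W z E) :
    E.memberSubfamily z ⊆ W.powersetCard r := by
  intro S hS
  obtain ⟨h1, h2⟩ := Finset.mem_memberSubfamily.1 hS
  have h3 := Finset.mem_powersetCard.1 (h.subset_powersetCard h1)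
  rw [Finset.card_insert_of_notMem h2] at h3
  refine Finset.mem_powersetCard.2 ⟨fun a ha ↦ ?_, by omega⟩
  exact (Finset.mem_insert.1 (h3.1 (Finset.mem_insert_of_mem ha))).resolve_left
    fun h ↦ h2 (h ▸ ha)

/-- Split by membership of z: without z every (j + 1)-subset of W occurs, and with z the link of z
takes over. The first term depends only on |W|, so comparisons pass to links. -/
lemma card_shadowLevel (h : IsCone (r + 1) W z E) (hj : j ≤ r) :
    (shadowLevel (j + 1) E).card =
      W.card.choose (j + 1) + (shadowLevel j (E.memberSubfamily z)).card := by
  rw [← Finset.card_memberSubfamily_add_card_nonMemberSubfamily z (shadowLevel (j + 1) E), add_comm,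
    ← Finset.card_powersetCard]
  congr 2
  · ext T
    rw [Finset.mem_nonMemberSubfamily, mem_shadowLevel, Finset.mem_powersetCard]
    constructor
    · rintro ⟨⟨h1, S, hS, hTS⟩, h2⟩
      have := (Finset.mem_powersetCard.1 (h.subset_powersetCard hS)).1
      exact ⟨(Finset.subset_insert_iff_of_notMem h2).1 (hTS.trans this), h1⟩
    · rintro ⟨h1, h2⟩
      refine ⟨⟨h2, ?_⟩, fun h3 ↦ h.notMem (h1 h3)⟩
      by_cases hr : r + 1 ≤ W.card
      · obtain ⟨S, hS1, hS2, hS3⟩ := Finset.exists_subsuperset_card_eq h1 (n := r + 1)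
          (by omega) hr
        exact ⟨S, h.powersetCard_subset (Finset.mem_powersetCard.2 ⟨hS2, hS3⟩), hS1⟩
      -- W has no (r + 1)-subset, so it is itself a member of the link and W ∪ {z} covers T.
      · obtain ⟨B, hB⟩ := h.nonempty
        have hBW := Finset.mem_powersetCard.1 (h.memberSubfamily_subset hB)
        have : B = W := Finset.eq_of_subset_of_card_le hBW.1 (by omega)
        exact ⟨_, (Finset.mem_memberSubfamily.1 hB).1,
          (this ▸ h1).trans (Finset.subset_insert _ _)⟩
  · ext T
    simp only [Finset.mem_memberSubfamily, mem_shadowLevel]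
    constructor
    · rintro ⟨⟨h1, S, hS, hTS⟩, h2⟩
      rw [Finset.card_insert_of_notMem h2] at h1
      have hzS : z ∈ S := hTS (Finset.mem_insert_self _ _)
      refine ⟨by omega, S.erase z, ⟨by rwa [Finset.insert_erase hzS], by simp⟩, ?_⟩
      exact fun a ha ↦ Finset.mem_erase.2
        ⟨fun h ↦ h2 (h ▸ ha), hTS (Finset.mem_insert_of_mem ha)⟩
    · rintro ⟨h1, S, ⟨hS, hz⟩, hTS⟩
      have h2 : z ∉ T := fun h ↦ hz (hTS h)
      exact ⟨⟨by rw [Finset.card_insert_of_notMem h2, h1], _, hS, Finset.insert_subset_insert _ hTS⟩,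
        h2⟩

/-- The same splitting for cliques. With r = 0 a clique of the link would not be confined to W,
since its only 0-subset is ∅. -/
lemma card_cliqueLevel (h : IsCone (r + 1) W z E) (hr : 1 ≤ r) (hj : r ≤ j) :
    (cliqueLevel (r + 1) (j + 1) E).card =
      W.card.choose (j + 1) + (cliqueLevel r j (E.memberSubfamily z)).card := by
  rw [← Finset.card_memberSubfamily_add_card_nonMemberSubfamily z (cliqueLevel (r + 1) (j + 1) E),
    add_comm, ← Finset.card_powersetCard]
  congr 2
  · ext T
    rw [Finset.mem_nonMemberSubfamily, mem_cliqueLevel, Finset.mem_powersetCard]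
    constructor
    · rintro ⟨⟨h1, h2⟩, h3⟩
      refine ⟨fun a ha ↦ ?_, h1⟩
      obtain ⟨R, hR1, hR2, hR3⟩ := exists_subset_card_eq_mem ha (r := r + 1) (by omega) (by omega)
      have := (Finset.mem_powersetCard.1
        (h.subset_powersetCard (h2 (Finset.mem_powersetCard.2 ⟨hR1, hR2⟩)))).1 hR3
      exact (Finset.mem_insert.1 this).resolve_left fun h ↦ h3 (h ▸ ha)
    · rintro ⟨h1, h2⟩
      exact ⟨⟨h2, (Finset.powersetCard_mono h1).trans h.powersetCard_subset⟩,
        fun h3 ↦ h.notMem (h1 h3)⟩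
  · ext T
    rw [Finset.mem_memberSubfamily, mem_cliqueLevel, mem_cliqueLevel]
    constructor
    · rintro ⟨⟨h1, h2⟩, h3⟩
      rw [Finset.card_insert_of_notMem h3] at h1
      refine ⟨by omega, fun R hR ↦ ?_⟩
      rw [Finset.mem_powersetCard] at hR
      have hzR : z ∉ R := fun h ↦ h3 (hR.1 h)
      refine Finset.mem_memberSubfamily.2 ⟨h2 (Finset.mem_powersetCard.2
        ⟨Finset.insert_subset_insert _ hR.1, ?_⟩), hzR⟩
      rw [Finset.card_insert_of_notMem hzR, hR.2]
    · rintro ⟨h1, h2⟩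
      have hTW : T ⊆ W := fun a ha ↦ by
        obtain ⟨R, hR1, hR2, hR3⟩ := exists_subset_card_eq_mem ha (r := r) hr (by omega)
        exact (Finset.mem_powersetCard.1 (h.memberSubfamily_subset
          (h2 (Finset.mem_powersetCard.2 ⟨hR1, hR2⟩)))).1 hR3
      have hzT : z ∉ T := fun hz ↦ h.notMem (hTW hz)
      refine ⟨⟨by rw [Finset.card_insert_of_notMem hzT, h1], fun S hS ↦ ?_⟩, hzT⟩
      rw [Finset.mem_powersetCard] at hS
      by_cases hz : z ∈ S
      · have hc := Finset.card_erase_add_one hz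
        have := h2 (Finset.mem_powersetCard.2 ⟨Finset.subset_insert_iff.1 hS.1, by omega⟩)
        rw [Finset.mem_memberSubfamily, Finset.insert_erase hz] at this
        exact this.1
      · exact h.powersetCard_subset (Finset.mem_powersetCard.2
          ⟨((Finset.subset_insert_iff_of_notMem hz).1 hS.1).trans hTW, hS.2⟩)

end IsCone

/-- Let p be the largest element used. A member containing p comes after every (r + 1)-set below p,
so all of those belong to 𝒜. -/
lemma exists_isCone_of_isInitSeg (h𝒜 : Finset.Colex.IsInitSeg 𝒜 (r + 1)) (hne : 𝒜.Nonempty) :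
    ∃ p, IsCone (r + 1) (Finset.Iio p) p 𝒜 ∧
      Finset.Colex.IsInitSeg (𝒜.memberSubfamily p) r := by
  have hX : (𝒜.biUnion id).Nonempty := by
    obtain ⟨S, hS⟩ := hne
    obtain ⟨a, ha⟩ : S.Nonempty := Finset.card_pos.1 (by rw [h𝒜.1 hS]; omega)
    exact ⟨a, Finset.mem_biUnion.2 ⟨S, hS, ha⟩⟩
  set p := (𝒜.biUnion id).max' hX
  have hp : ∀ S ∈ 𝒜, ∀ a ∈ S, a ≤ p := fun S hS a ha ↦
    Finset.le_max' _ _ (Finset.mem_biUnion.2 ⟨S, hS, ha⟩)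
  obtain ⟨S, hS, hpS⟩ := Finset.mem_biUnion.1 ((𝒜.biUnion id).max'_mem hX)
  change p ∈ S at hpS
  refine ⟨p, ⟨by simp, fun T hT ↦ ?_, fun T hT ↦ ?_, S.erase p, ?_⟩, ?_, ?_⟩
  · rw [Finset.mem_powersetCard] at hT
    have hpT : p ∉ T := fun h ↦ by simpa using hT.1 h
    refine h𝒜.2 hS ⟨Finset.Colex.toColex_lt_toColex.2 ⟨?_, fun a ha _ ↦ ⟨p, hpS, hpT, ?_⟩⟩, hT.2⟩
    · exact fun h ↦ hpT (h ▸ hpS)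
    · exact (Finset.mem_Iio.1 (hT.1 ha)).le
  · refine Finset.mem_powersetCard.2 ⟨fun a ha ↦ ?_, h𝒜.1 hT⟩
    rw [Finset.mem_insert, Finset.mem_Iio]
    exact (hp T hT a ha).eq_or_lt
  · rw [Finset.mem_memberSubfamily, Finset.insert_erase hpS]
    exact ⟨hS, by simp⟩
  · intro T hT
    rw [Finset.mem_coe, Finset.mem_memberSubfamily] at hT
    have := h𝒜.1 hT.1
    rw [Finset.card_insert_of_notMem hT.2] at this
    omega
  · intro T R hT hR
    rw [Finset.mem_memberSubfamily] at hT ⊢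
    have hTp : ∀ b ∈ T, b < p := fun b hb ↦
      (hp _ hT.1 b (Finset.mem_insert_of_mem hb)).lt_of_ne fun h ↦ hT.2 (h ▸ hb)
    have hpR : p ∉ R := fun h ↦ (Finset.Colex.forall_lt_mono hR.1.le hTp p h).false
    have hlt := Finset.Colex.toColex_lt_toColex.1 hR.1
    refine ⟨h𝒜.2 hT.1 ⟨Finset.Colex.toColex_lt_toColex.2 ⟨fun h ↦ hlt.1 ?_, fun a ha hb ↦ ?_⟩, ?_⟩,
      hpR⟩
    · rw [← Finset.erase_insert hpR, h, Finset.erase_insert hT.2]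
    · rw [Finset.mem_insert, not_or] at hb
      obtain ⟨b, hb1, hb2, hb3⟩ := hlt.2 ((Finset.mem_insert.1 ha).resolve_left hb.1) hb.2
      refine ⟨b, Finset.mem_insert_of_mem hb1, ?_, hb3⟩
      rw [Finset.mem_insert, not_or]
      exact ⟨(hTp b hb1).ne, hb2⟩
    · rw [Finset.card_insert_of_notMem hpR, hR.2]

lemma card_biUnion_le_card_shadowLevel (E : Finset (Finset (Fin n))) :
    (E.biUnion id).card ≤ (shadowLevel 1 E).card := by
  refine Finset.card_le_card_of_injOn (fun a ↦ {a}) (fun a ha ↦ ?_)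
    (fun a _ b _ h ↦ Finset.singleton_injective h)
  obtain ⟨S, hS, haS⟩ := Finset.mem_biUnion.1 ha
  exact mem_shadowLevel.2 ⟨by simp, S, hS, Finset.singleton_subset_iff.2 haS⟩

/-- The shadow at level 1 bounds the support of E by |W| + 1, and the clique count at level |W|
provides W'. As |E| exceeds the number of (r + 1)-subsets of W', some member leaves W', and its
extra point z' exhausts the support. -/
lemma IsCone.exists_isCone (h : IsCone (r + 1) W z 𝒜)
    (hE : (E : Set (Finset (Fin n))).Sized (r + 1)) (hcard : E.card = 𝒜.card)
    (hsh : ∀ j ≤ r + 1, (shadowLevel j E).card ≤ (shadowLevel j 𝒜).card)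
    (hcl : ∀ j ≥ r + 1, (cliqueLevel (r + 1) j 𝒜).card ≤ (cliqueLevel (r + 1) j E).card) :
    ∃ W' z', W'.card = W.card ∧ IsCone (r + 1) W' z' E := by
  have hX : (E.biUnion id).card ≤ W.card + 1 := by
    refine (card_biUnion_le_card_shadowLevel E).trans ((hsh 1 (by omega)).trans ?_)
    rw [← Finset.card_insert_of_notMem h.notMem, ← Nat.choose_one_right (insert z W).card,
      ← Finset.card_powersetCard]
    refine Finset.card_le_card fun T hT ↦ ?_
    obtain ⟨hT, S, hS, hTS⟩ := mem_shadowLevel.1 hT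
    exact Finset.mem_powersetCard.2
      ⟨hTS.trans (Finset.mem_powersetCard.1 (h.subset_powersetCard hS)).1, hT⟩
  have hpos := h.nonempty.card_pos
  have hEX : ∀ S ∈ E, S ⊆ E.biUnion id := fun S hS ↦ Finset.subset_biUnion_of_mem id hS
  by_cases hr : r + 1 ≤ W.card
  · obtain ⟨W', hW'⟩ : (cliqueLevel (r + 1) W.card E).Nonempty := by
      refine Finset.card_pos.1 (lt_of_lt_of_le (Finset.card_pos.2 ⟨W, ?_⟩) (hcl _ hr))
      exact mem_cliqueLevel.2 ⟨rfl, h.powersetCard_subset⟩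
    obtain ⟨hc, hW'⟩ := mem_cliqueLevel.1 hW'
    obtain ⟨S, hS, hSW⟩ : ∃ S ∈ E, S ∉ W'.powersetCard (r + 1) := by
      by_contra! hcon
      have := Finset.card_le_card (show E ⊆ W'.powersetCard (r + 1) from hcon)
      rw [Finset.card_powersetCard, hc, hcard, h.card_eq] at this
      omega
    obtain ⟨z', hzS, hzW⟩ : ∃ z' ∈ S, z' ∉ W' := by
      by_contra! hcon
      exact hSW (Finset.mem_powersetCard.2 ⟨hcon, hE hS⟩)
    have hsub : insert z' W' ⊆ E.biUnion id := by
      refine Finset.insert_subset (hEX S hS hzS) fun a ha ↦ ?_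
      obtain ⟨R, hR1, hR2, hR3⟩ := exists_subset_card_eq_mem ha (r := r + 1) (by omega) (by omega)
      exact hEX R (hW' (Finset.mem_powersetCard.2 ⟨hR1, hR2⟩)) hR3
    have heq := Finset.eq_of_subset_of_card_le hsub
      (by rw [Finset.card_insert_of_notMem hzW]; omega)
    refine ⟨W', z', hc, hzW, hW', fun T hT ↦ ?_, S.erase z', ?_⟩
    · exact Finset.mem_powersetCard.2 ⟨heq ▸ hEX T hT, hE hT⟩
    · rw [Finset.mem_memberSubfamily, Finset.insert_erase hzS]
      exact ⟨hS, by simp⟩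
  -- Now |W| = r, so the support of E has at most r + 1 points and E is a single set.
  · obtain ⟨B, hB⟩ := h.nonempty
    have hBW := Finset.mem_powersetCard.1 (h.memberSubfamily_subset hB)
    have hBc := Finset.card_le_card hBW.1
    obtain ⟨S, hS⟩ : E.Nonempty := Finset.card_pos.1 (by rw [hcard, h.card_eq]; omega)
    have hSc := hE hS
    have heq := Finset.eq_of_subset_of_card_le (hEX S hS) (by omega)
    obtain ⟨z', hz'⟩ : S.Nonempty := Finset.card_pos.1 (by omega)
    have hc := Finset.card_erase_add_one hz'
    refine ⟨S.erase z', z', by omega, by simp, ?_, fun T hT ↦ ?_, S.erase z', ?_⟩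
    · rw [Finset.powersetCard_eq_empty.2 (by omega)]
      exact Finset.empty_subset _
    · rw [Finset.insert_erase hz', heq]
      exact Finset.mem_powersetCard.2 ⟨hEX T hT, hE hT⟩
    · rw [Finset.mem_memberSubfamily, Finset.insert_erase hz']
      exact ⟨hS, by simp⟩

/-- A permutation matching the links matters only on the support U of the link; off U it can be
changed so that K goes to W and the apex p to z. -/
lemma exists_perm_extending {K : Finset (Fin n)} (hKW : K.card = W.card) (hp : p ∉ K) (hz : z ∉ W)
    (hU : U ⊆ K) (σ : Equiv.Perm (Fin n)) (hσ : U.image σ ⊆ W) :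
    ∃ τ : Equiv.Perm (Fin n), (∀ a ∈ U, τ a = σ a) ∧ K.image τ ⊆ W ∧ τ p = z := by
  obtain ⟨g, hg⟩ := Finset.exists_equiv_extend_of_card_eq (α := K) (t := W)
    (s := Finset.univ.filter fun a : K ↦ (a : Fin n) ∈ U) (f := fun a ↦ σ a) (by simpa using hKW)
    (by
      intro b hb
      obtain ⟨a, ha, rfl⟩ := Finset.mem_image.1 hb
      exact hσ (Finset.mem_image_of_mem _ (Finset.mem_filter.1 ha).2))
    (fun a _ b _ h ↦ Subtype.ext (σ.injective h))
  let f : Fin n → Fin n := fun a ↦ if h : a ∈ K then g ⟨a, h⟩ else z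
  have hfK : ∀ a (h : a ∈ K), f a = g ⟨a, h⟩ := fun a h ↦ dif_pos h
  have hfp : f p = z := dif_neg hp
  have hfW : ∀ a ∈ K, f a ∈ W := fun a h ↦ by rw [hfK a h]; exact (g ⟨a, h⟩).2
  obtain ⟨τ, hτ⟩ := Finset.exists_equiv_extend_of_card_eq (α := Fin n) (t := Finset.univ)
    (s := insert p K) (f := f) (by simp) (Finset.subset_univ _) (by
      intro a ha b hb hab
      rw [Finset.mem_coe, Finset.mem_insert] at ha hb
      rcases ha with rfl | ha <;> rcases hb with rfl | hb
      · rfl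
      · exact absurd (hab ▸ hfW b hb) (hfp ▸ hz)
      · exact absurd (hab ▸ hfW a ha) (hfp ▸ hz)
      · rw [hfK a ha, hfK b hb] at hab
        exact congrArg Subtype.val (g.injective (Subtype.ext hab)))
  refine ⟨τ.trans (Equiv.subtypeUnivEquiv Finset.mem_univ), fun a ha ↦ ?_, fun b hb ↦ ?_, ?_⟩
  · have haK := hU ha
    change (τ a : Fin n) = _
    rw [hτ a (Finset.mem_insert_of_mem haK), hfK a haK, hg ⟨a, haK⟩ (by simpa using ha)]
  · obtain ⟨a, ha, rfl⟩ := Finset.mem_image.1 hb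
    change (τ a : Fin n) ∈ _
    rw [hτ a (Finset.mem_insert_of_mem ha)]
    exact hfW a ha
  · change (τ p : Fin n) = _
    rw [hτ p (Finset.mem_insert_self _ _), hfp]

lemma exists_image_eq_of_isCone {p z : Fin n} {K : Finset (Fin n)} (h𝒜 : IsCone (r + 1) K p 𝒜)
    (hE : IsCone (r + 1) W z E) (hKW : K.card = W.card) (hcard : E.card = 𝒜.card)
    (h : ∃ σ : Equiv.Perm (Fin n),
      (𝒜.memberSubfamily p).image (Finset.image σ) = E.memberSubfamily z) :
    ∃ σ : Equiv.Perm (Fin n), 𝒜.image (Finset.image σ) = E := by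
  obtain ⟨σ, hσ⟩ := h
  obtain ⟨τ, hτ1, hτ2, hτ3⟩ := exists_perm_extending (U := (𝒜.memberSubfamily p).biUnion id)
    hKW h𝒜.notMem hE.notMem
    (Finset.biUnion_subset.2 fun S hS ↦
      (Finset.mem_powersetCard.1 (h𝒜.memberSubfamily_subset hS)).1) σ (by
      intro b hb
      obtain ⟨a, ha, rfl⟩ := Finset.mem_image.1 hb
      obtain ⟨S, hS, haS⟩ := Finset.mem_biUnion.1 ha
      have := hσ ▸ Finset.mem_image_of_mem (Finset.image σ) hS
      exact (Finset.mem_powersetCard.1 (hE.memberSubfamily_subset this)).1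
        (Finset.mem_image_of_mem _ haS))
  refine ⟨τ, Finset.eq_of_subset_of_card_le (fun T hT ↦ ?_) ?_⟩
  · obtain ⟨S, hS, rfl⟩ := Finset.mem_image.1 hT
    by_cases hp : p ∈ S
    · have hS' : S.erase p ∈ 𝒜.memberSubfamily p := by
        rw [Finset.mem_memberSubfamily, Finset.insert_erase hp]
        exact ⟨hS, by simp⟩
      have h1 : (S.erase p).image τ = (S.erase p).image σ :=
        Finset.image_congr fun a ha ↦ hτ1 a (Finset.mem_biUnion.2 ⟨_, hS', ha⟩)
      have h2 := hσ ▸ Finset.mem_image_of_mem (Finset.image σ) hS'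
      rw [← h1] at h2
      rw [← Finset.insert_erase hp, Finset.image_insert, hτ3]
      exact (Finset.mem_memberSubfamily.1 h2).1
    · have h1 := Finset.mem_powersetCard.1
        (h𝒜.nonMemberSubfamily_eq ▸ Finset.mem_nonMemberSubfamily.2 ⟨hS, hp⟩)
      refine hE.powersetCard_subset (Finset.mem_powersetCard.2
        ⟨(Finset.image_subset_image h1.1).trans hτ2, ?_⟩)
      rw [Finset.card_image_of_injective _ τ.injective, h1.2]
  · rw [Finset.card_image_of_injective _ (Finset.image_injective τ.injective), hcard]

/-- A family of `s`-element sets whose iterated shadows are as small, and whose sets of cliques are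
as large, as for an initial segment of colex is isomorphic to that initial segment. -/
lemma exists_image_eq_of_isInitSeg (h𝒜 : Finset.Colex.IsInitSeg 𝒜 s)
    (hE : (E : Set (Finset (Fin n))).Sized s) (hcard : E.card = 𝒜.card)
    (hsh : ∀ j ≤ s, (shadowLevel j E).card ≤ (shadowLevel j 𝒜).card)
    (hcl : 1 ≤ s → ∀ j ≥ s, (cliqueLevel s j 𝒜).card ≤ (cliqueLevel s j E).card) :
    ∃ σ : Equiv.Perm (Fin n), 𝒜.image (Finset.image σ) = E := by
  induction s generalizing 𝒜 E with
  | zero =>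
    have h1 : 𝒜 ⊆ {∅} := fun S hS ↦ by simpa using h𝒜.1 hS
    have h2 : E ⊆ {∅} := fun S hS ↦ by simpa using hE hS
    refine ⟨Equiv.refl _, ?_⟩
    have : Finset.image (Equiv.refl (Fin n)) = id := by ext; simp
    rw [this, Finset.image_id]
    rcases Finset.subset_singleton_iff.1 h1 with rfl | rfl <;>
      rcases Finset.subset_singleton_iff.1 h2 with rfl | rfl <;> simp_all
  | succ r ih =>
    rcases 𝒜.eq_empty_or_nonempty with rfl | hne
    · exact ⟨Equiv.refl _, by simpa [eq_comm] using hcard⟩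
    obtain ⟨p, hp, hinit⟩ := exists_isCone_of_isInitSeg h𝒜 hne
    obtain ⟨W, z, hW, hz⟩ := hp.exists_isCone hE hcard hsh (hcl (by omega))
    -- Since the two bases have equal size, their binomial contributions cancel and every hypothesis
    -- descends to the links.
    refine exists_image_eq_of_isCone hp hz hW.symm hcard (ih hinit ?_ ?_ ?_ ?_)
    · intro S hS
      exact (Finset.mem_powersetCard.1 (hz.memberSubfamily_subset hS)).2
    · have h1 := hp.card_eq
      have h2 := hz.card_eq
      rw [hW] at h2
      omega
    · intro j hj
      have h1 := hp.card_shadowLevel hj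
      have h2 := hz.card_shadowLevel hj
      have h3 := hsh (j + 1) (by omega)
      rw [hW] at h2
      omega
    · intro hr j hj
      have h1 := hp.card_cliqueLevel hr hj
      have h2 := hz.card_cliqueLevel hr hj
      have h3 := hcl (by omega) (j + 1) (by omega)
      rw [hW] at h2
      omega

end Hypercube

namespace Hypercube

variable {n : ℕ} {A B H E 𝒜 : Finset (Finset (Fin n))} {x y U V S T R W : Finset (Fin n)}
  {r s t j m : ℕ} {i z p : Fin n}

/-! ### Classification of the extremal sets -/

lemma shadow_iterate_eq_shadowLevel (hE : (E : Set (Finset (Fin n))).Sized (j + t)) :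
    ∂^[t] E = shadowLevel j E := by
  ext T
  rw [Finset.mem_shadow_iterate_iff_exists_mem_card_add, mem_shadowLevel]
  constructor
  · rintro ⟨S, hS, hTS, hc⟩
    have := hE hS
    exact ⟨by omega, S, hS, hTS⟩
  · rintro ⟨hT, S, hS, hTS⟩
    exact ⟨S, hS, hTS, by rw [hE hS, hT]⟩

/-- After complementation the t-fold shadow consists of the (s + t)-sets having some s-subset
outside E, that is, the non-cliques. -/
lemma card_shadow_iterate_coFamily (s t : ℕ) (E : Finset (Finset (Fin n))) :
    (∂^[t] (coFamily s E)).card + (cliqueLevel s (s + t) E).card = n.choose (s + t) := by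
  have key : (∂^[t] (coFamily s E)).card =
      ((Finset.univ.powersetCard (s + t)).filter fun T ↦ ¬ T.powersetCard s ⊆ E).card := by
    refine Finset.card_nbij' compl compl (fun T hT ↦ ?_) (fun T hT ↦ ?_)
      (fun T _ ↦ compl_compl T) (fun T _ ↦ compl_compl T)
    · rw [Finset.mem_coe, Finset.mem_shadow_iterate_iff_exists_mem_card_add] at hT
      obtain ⟨S, hS, hTS, hc⟩ := hT
      rw [mem_coFamily] at hS
      have h1 := card_compl_add S
      have h2 := card_compl_add T
      rw [Finset.mem_coe, Finset.mem_filter, Finset.mem_powersetCard]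
      exact ⟨⟨Finset.subset_univ _, by omega⟩, fun h ↦ hS.2 (h (Finset.mem_powersetCard.2
        ⟨Finset.compl_subset_compl.2 hTS, hS.1⟩))⟩
    · rw [Finset.mem_coe, Finset.mem_filter, Finset.mem_powersetCard, Finset.not_subset] at hT
      obtain ⟨⟨-, hT⟩, S, hS, hSE⟩ := hT
      rw [Finset.mem_powersetCard] at hS
      have h1 := card_compl_add S
      have h2 := card_compl_add T
      rw [Finset.mem_coe, Finset.mem_shadow_iterate_iff_exists_mem_card_add]
      refine ⟨Sᶜ, mem_coFamily.2 ?_, Finset.compl_subset_compl.2 hS.1, by omega⟩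
      rw [compl_compl]
      exact ⟨hS.2, hSE⟩
  have key' : cliqueLevel s (s + t) E =
      (Finset.univ.powersetCard (s + t)).filter fun T ↦ T.powersetCard s ⊆ E := by
    ext T
    simp [mem_cliqueLevel]
  rw [key, key', add_comm, Finset.card_filter_add_card_filter_not, Finset.card_powersetCard,
    Finset.card_univ, Fintype.card_fin]

/-- The extremality of `A` is compared with that of a set of the same size. -/
lemma Extremal.card_nbhd_le (hA : Extremal A) (h : B.card = A.card) (t : ℕ) :
    (nbhd t A).card ≤ (nbhd t B).card ∧ (nbhd t Aᶜ).card ≤ (nbhd t Bᶜ).card := by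
  have h' : Bᶜ.card = Aᶜ.card := by rw [Finset.card_compl, Finset.card_compl, h]
  obtain rfl | ht := Nat.eq_zero_or_pos t
  · simp [nbhd_zero, h, h']
  · exact ⟨hA.1 t ht B h, hA.2 t ht Bᶜ h'⟩

lemma card_nbhd_sectionSet (hE : (E : Set (Finset (Fin n))).Sized (s + t)) (hs : s + t < n)
    (i : Fin n) : (nbhd t (sectionSet (s + t) E i)).card =
      (layersGE n (s + 1)).card + (∂^[t] E).card := by
  rw [nbhd_sectionSet hE (Or.inl hs), card_sectionSet]
  intro S hS
  rw [hE.shadow_iterate hS, Nat.add_sub_cancel]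

lemma card_nbhd_compl_sectionSet (hE : (E : Set (Finset (Fin n))).Sized s) (hs : 1 ≤ s)
    (ht : s + t ≤ n) (i : Fin n) : (nbhd t (sectionSet s E i)ᶜ).card =
      (layersGE n (n - (s + t) + 1)).card + (∂^[t] (coFamily s E)).card := by
  rw [((isomorphic_compl_sectionSet (by omega) hE i).nbhd t).card_eq]
  have hco := sized_coFamily (s := s) (E := E)
  have : n - s = n - (s + t) + t := by omega
  rw [this] at hco ⊢
  exact card_nbhd_sectionSet hco (by omega) i

lemma exists_image_eq_of_extremal (h𝒜 : Finset.Colex.IsInitSeg 𝒜 s)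
    (hE : (E : Set (Finset (Fin n))).Sized s) (hs : s < n) (hcard : E.card = 𝒜.card)
    (hA : Extremal (sectionSet s E i)) :
    ∃ σ : Equiv.Perm (Fin n), 𝒜.image (Finset.image σ) = E := by
  have hcard' : (sectionSet s 𝒜 i).card = (sectionSet s E i).card := by
    rw [card_sectionSet h𝒜.1, card_sectionSet hE, hcard]
  refine exists_image_eq_of_isInitSeg h𝒜 hE hcard (fun j hj ↦ ?_) (fun h1 j hj ↦ ?_)
  · obtain ⟨t, rfl⟩ := Nat.exists_eq_add_of_le hj
    have := (hA.card_nbhd_le hcard' t).1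
    rw [card_nbhd_sectionSet hE hs, card_nbhd_sectionSet h𝒜.1 hs] at this
    rw [← shadow_iterate_eq_shadowLevel hE, ← shadow_iterate_eq_shadowLevel h𝒜.1]
    omega
  · obtain ⟨t, rfl⟩ := Nat.exists_eq_add_of_le hj
    by_cases ht : s + t ≤ n
    · have := (hA.card_nbhd_le hcard' t).2
      rw [card_nbhd_compl_sectionSet hE h1 ht, card_nbhd_compl_sectionSet h𝒜.1 h1 ht] at this
      have e1 := card_shadow_iterate_coFamily s t E
      have e2 := card_shadow_iterate_coFamily s t 𝒜
      omega
    -- No set has more than n elements, so there is nothing to compare.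
    · have : cliqueLevel s (s + t) 𝒜 = ∅ := by
        refine Finset.eq_empty_of_forall_notMem fun T hT ↦ ht ?_
        rw [← (mem_cliqueLevel.1 hT).1]
        simpa using Finset.card_le_univ T
      simp [this]

lemma sectionSet_image (s : ℕ) (𝒜 : Finset (Finset (Fin n))) (σ : Equiv.Perm (Fin n))
    (i : Fin n) : (sectionSet s 𝒜 i).image (Finset.image σ) =
      sectionSet s (𝒜.image (Finset.image σ)) (σ i) := by
  have hinj := Finset.image_injective σ.injective
  have hsurj : Function.Surjective (Finset.image σ : Finset (Fin n) → Finset (Fin n)) :=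
    fun x ↦ ⟨x.image σ.symm, by simp [Finset.image_image]⟩
  ext x
  obtain ⟨x, rfl⟩ := hsurj x
  rw [hinj.mem_finset_image, mem_sectionSet, mem_sectionSet, ← Finset.image_insert,
    hinj.mem_finset_image, hinj.mem_finset_image, σ.injective.mem_finset_image,
    Finset.card_image_of_injective _ σ.injective]

lemma univ_symmDiff (x : Finset (Fin n)) : symmDiff Finset.univ x = xᶜ := by
  ext a; simp [Finset.mem_symmDiff]

lemma dist_singleton_of_mem (h : i ∈ x) : dist {i} x + 1 = x.card := by
  have : symmDiff {i} x = x.erase i := by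
    ext a; simp only [Finset.mem_symmDiff, Finset.mem_singleton, Finset.mem_erase]; grind
  rw [dist, this, Finset.card_erase_add_one h]

lemma dist_singleton_of_notMem (h : i ∉ x) : dist {i} x = x.card + 1 := by
  have : symmDiff {i} x = insert i x := by
    ext a; simp only [Finset.mem_symmDiff, Finset.mem_singleton, Finset.mem_insert]; grind
  rw [dist, this, Finset.card_insert_of_notMem h]

/-- Distance at least s from {i} forces |B| ≥ s + 1 when i ∈ B and |B| ≥ s - 1 otherwise. So below
the full layers only sets avoiding i of size s or s - 1 remain; adding i to the latter recovers E.
-/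
lemma exists_eq_sectionSet (hA : layersGE n (s + 1) ⊆ A) (hi : ∀ B ∈ A, s ≤ dist {i} B) :
    ∃ E : Finset (Finset (Fin n)), (E : Set (Finset (Fin n))).Sized s ∧ A = sectionSet s E i := by
  refine ⟨Finset.univ.filter fun S ↦ S.card = s ∧ (i ∉ S ∧ S ∈ A ∨ i ∈ S ∧ S.erase i ∈ A),
    fun S hS ↦ by simpa using (Finset.mem_filter.1 hS).2.1, ?_⟩
  ext x
  rw [mem_sectionSet]
  simp only [Finset.mem_filter, Finset.mem_univ, true_and, Finset.mem_insert_self, not_true_eq_false,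
    false_and, false_or]
  by_cases hx : s + 1 ≤ x.card
  · simp [hx, hA (mem_layersGE.2 hx)]
  by_cases hix : i ∈ x
  · have h1 := dist_singleton_of_mem hix
    simp only [hx, hix, not_true_eq_false, false_and, or_false, iff_false]
    intro h
    have := hi x h
    omega
  · have h1 := dist_singleton_of_notMem hix
    rw [Finset.erase_insert hix, Finset.card_insert_of_notMem hix]
    simp only [hx, hix, not_false_eq_true, true_and, false_or, false_and, or_false]
    constructor
    · intro h
      have := hi x h
      have : x.card = s ∨ x.card + 1 = s := by omega
      tauto
    · tauto

/-- A larger y lies in A itself or extends to an (s + 1)-set in A at distance s + 1 - |y| < s. -/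
lemma card_le_one_of_forall_le_dist (hs : 1 ≤ s) (hsn : s < n) (hA : layersGE n (s + 1) ⊆ A)
    (hy : ∀ B ∈ A, s ≤ dist y B) : y.card ≤ 1 := by
  by_cases h : s + 1 ≤ y.card
  · have := hy y (hA (mem_layersGE.2 h))
    rw [dist_self] at this
    omega
  · obtain ⟨B, hB1, -, hB2⟩ := Finset.exists_subsuperset_card_eq (Finset.subset_univ y)
      (n := s + 1) (by omega) (by simpa using hsn)
    have h1 := hy B (hA (mem_layersGE.2 hB2.ge))
    rw [dist, symmDiff_of_le hB1, Finset.card_sdiff_of_subset hB1] at h1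
    omega

/-- The s-sets avoiding the last element form a colex segment of size C(n - 1, s), and segments are
nested. -/
lemma forall_notMem_of_card_le (h𝒜 : Finset.Colex.IsInitSeg 𝒜 s)
    (hcard : 𝒜.card ≤ (n - 1).choose s) (hi : (i : ℕ) = n - 1) : ∀ S ∈ 𝒜, i ∉ S := by
  have hle : ∀ a : Fin n, a ≤ i := fun a ↦ Fin.le_def.2 (by omega)
  have hseg : Finset.Colex.IsInitSeg ((Finset.univ.erase i).powersetCard s) s := by
    refine ⟨fun S hS ↦ (Finset.mem_powersetCard.1 hS).2, fun S T hS hT ↦ ?_⟩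
    rw [Finset.mem_powersetCard] at hS ⊢
    have hS' : ∀ b ∈ S, b < i := fun b hb ↦ (hle b).lt_of_ne (Finset.mem_erase.1 (hS.1 hb)).1
    exact ⟨fun a ha ↦ Finset.mem_erase.2
      ⟨(Finset.Colex.forall_lt_mono hT.1.le hS' a ha).ne, Finset.mem_univ _⟩, hT.2⟩
  have hc : ((Finset.univ.erase i).powersetCard s).card = (n - 1).choose s := by
    rw [Finset.card_powersetCard, Finset.card_erase_of_mem (Finset.mem_univ _), Finset.card_univ,
      Fintype.card_fin]
  have hsub : 𝒜 ⊆ (Finset.univ.erase i).powersetCard s := by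
    rcases h𝒜.total hseg with h | h
    · exact h
    · exact (Finset.eq_of_subset_of_card_le h (by omega)).ge
  exact fun S hS hiS ↦ by simpa using (Finset.mem_powersetCard.1 (hsub hS)).1 hiS

/-- An extremal set containing a large Hamming ball around `univ` lies in the complement of a ball
around some singleton. -/
lemma exists_forall_le_dist (h𝒜 : Finset.Colex.IsInitSeg 𝒜 s)
    (hcard : 𝒜.card ≤ (n - 1).choose s) (hs : s < n) (hi : (i : ℕ) = n - 1)
    (hA : Extremal A) (hAc : A.card = (sectionSet s 𝒜 i).card) (hball : layersGE n (s + 1) ⊆ A) :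
    ∃ k : Fin n, ∀ B ∈ A, s ≤ dist {k} B := by
  obtain rfl | hs1 := Nat.eq_zero_or_pos s
  · exact ⟨i, fun B _ ↦ Nat.zero_le _⟩
  have hmem : ∀ B ∈ sectionSet s 𝒜 i, s ≤ B.card ∧ s ≤ dist {i} B := by
    intro B hB
    have h0 := forall_notMem_of_card_le h𝒜 hcard hi
    rcases mem_sectionSet.1 hB with h | ⟨h1, h | h⟩
    · refine ⟨by omega, ?_⟩
      by_cases hiB : i ∈ B
      · have := dist_singleton_of_mem hiB
        omega
      · have := dist_singleton_of_notMem hiB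
        omega
    · have h2 := h𝒜.1 h
      have := dist_singleton_of_notMem h1
      omega
    · exact absurd (Finset.mem_insert_self _ _) (h0 _ h)
  -- Two missed points are needed: one may be ∅, which says nothing about the position of the
  -- singleton.
  have h2 : 1 < (nbhd (s - 1) (sectionSet s 𝒜 i))ᶜ.card := by
    rw [Finset.one_lt_card]
    refine ⟨∅, ?_, {i}, ?_, by simp⟩
    · rw [Finset.mem_compl, mem_nbhd]
      rintro ⟨B, hB, hd⟩
      have := (hmem B hB).1
      simp only [dist, ← Finset.bot_eq_empty, bot_symmDiff] at hd
      omega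
    · rw [Finset.mem_compl, mem_nbhd]
      rintro ⟨B, hB, hd⟩
      have := (hmem B hB).2
      omega
  have h3 : 1 < (nbhd (s - 1) A)ᶜ.card := by
    have := (hA.card_nbhd_le hAc.symm (s - 1)).1
    rw [Finset.card_compl] at h2 ⊢
    omega
  obtain ⟨y, hy, hy0⟩ := Finset.exists_mem_ne h3 ∅
  have hy' : ∀ B ∈ A, s ≤ dist y B := fun B hB ↦ by
    by_contra h
    exact Finset.mem_compl.1 hy (mem_nbhd.2 ⟨B, hB, by omega⟩)
  have h4 := card_le_one_of_forall_le_dist hs1 hs hball hy'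
  have h5 := (Finset.nonempty_iff_ne_empty.2 hy0).card_pos
  obtain ⟨k, rfl⟩ := Finset.card_eq_one.1 (show y.card = 1 by omega)
  exact ⟨k, hy'⟩

/-- A point x missed by N^(n-1-s)(Aᶜ) is the centre of a ball of that radius inside A; translating
by xᶜ moves x to X and the ball to X^(≥s+1). -/
lemma Extremal.exists_isomorphic_layersGE_subset (hs : s < n)
    (hA : Extremal A) (hAc : A.card = (sectionSet s 𝒜 i).card) :
    ∃ A', Isomorphic A A' ∧ layersGE n (s + 1) ⊆ A' := by
  have h1 : (Finset.univ : Finset (Fin n)) ∉ nbhd (n - 1 - s) (sectionSet s 𝒜 i)ᶜ := by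
    rw [mem_nbhd]
    rintro ⟨B, hB, hd⟩
    rw [Finset.mem_compl, mem_sectionSet, not_or] at hB
    rw [dist, univ_symmDiff] at hd
    have := card_compl_add B
    omega
  obtain ⟨x, hx⟩ : ∃ x, x ∉ nbhd (n - 1 - s) Aᶜ := by
    by_contra! h
    rw [← Finset.eq_univ_iff_forall] at h
    have h2 := (hA.card_nbhd_le hAc.symm (n - 1 - s)).2
    rw [h] at h2
    rw [Finset.eq_univ_of_card _ (le_antisymm (Finset.card_le_univ _) h2)] at h1
    exact h1 (Finset.mem_univ _)
  refine ⟨_, isomorphic_image_symmDiff A xᶜ, fun y hy ↦ ?_⟩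
  rw [mem_layersGE] at hy
  refine Finset.mem_image.2 ⟨symmDiff xᶜ y, ?_, symmDiff_symmDiff_cancel_left _ _⟩
  by_contra h
  refine hx (mem_nbhd.2 ⟨_, Finset.mem_compl.2 h, ?_⟩)
  have h3 : symmDiff x (symmDiff xᶜ y) = yᶜ := by
    rw [← symmDiff_assoc, symmDiff_compl_self, Finset.top_eq_univ, univ_symmDiff]
  have := card_compl_add y
  rw [dist, h3]
  omega

lemma Extremal.exists_isomorphic_sectionSet (h𝒜 : Finset.Colex.IsInitSeg 𝒜 s)
    (hcard : 𝒜.card ≤ (n - 1).choose s) (hs : s < n) (hA : Extremal A)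
    (hAc : ∀ i, A.card = (sectionSet s 𝒜 i).card) :
    ∃ i, Isomorphic A (sectionSet s 𝒜 i) := by
  let l : Fin n := ⟨n - 1, by omega⟩
  obtain ⟨A', hAA', hball⟩ := hA.exists_isomorphic_layersGE_subset hs (hAc l)
  have hA' : Extremal A' := hAA'.symm.extremal hA
  have hAc' : A'.card = (sectionSet s 𝒜 l).card := hAA'.card_eq.symm.trans (hAc l)
  obtain ⟨k, hk⟩ := exists_forall_le_dist h𝒜 hcard hs rfl hA' hAc' hball
  obtain ⟨E, hE, rfl⟩ := exists_eq_sectionSet hball hk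
  rw [card_sectionSet hE, card_sectionSet h𝒜.1] at hAc'
  obtain ⟨σ, rfl⟩ := exists_image_eq_of_extremal h𝒜 hE hs (by omega) hA'
  refine ⟨σ.symm k, hAA'.trans (Isomorphic.symm ?_)⟩
  have := isomorphic_image_map (sectionSet s 𝒜 (σ.symm k)) σ
  rwa [sectionSet_image, Equiv.apply_symm_apply] at this

/-! ### Existence of the initial segment -/

lemma exists_isInitSeg_card_eq (n s : ℕ) {m : ℕ} (hm : m ≤ n.choose s) :
    ∃ 𝒜 : Finset (Finset (Fin n)), Finset.Colex.IsInitSeg 𝒜 s ∧ 𝒜.card = m := by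
  induction m with
  | zero => exact ⟨∅, by simp, rfl⟩
  | succ m ih =>
    obtain ⟨𝒜, h𝒜, hc⟩ := ih (by omega)
    have hne : (Finset.univ.powersetCard s \ 𝒜).Nonempty := by
      rw [← Finset.card_pos]
      have := Finset.le_card_sdiff 𝒜 (Finset.univ.powersetCard s)
      rw [Finset.card_powersetCard, Finset.card_univ, Fintype.card_fin] at this
      omega
    obtain ⟨S, hS, hmin⟩ := Finset.exists_min_image _ toColex hne
    rw [Finset.mem_sdiff, Finset.mem_powersetCard] at hS
    refine ⟨insert S 𝒜, ⟨fun T hT ↦ ?_, fun T R hT hR ↦ ?_⟩, by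
      rw [Finset.card_insert_of_notMem hS.2, hc]⟩
    · rcases Finset.mem_insert.1 hT with rfl | hT
      · exact hS.1.2
      · exact h𝒜.1 hT
    · refine Finset.mem_insert_of_mem ?_
      rcases Finset.mem_insert.1 hT with rfl | hT
      · by_contra hR'
        exact hR.1.not_ge (hmin R (Finset.mem_sdiff.2
          ⟨Finset.mem_powersetCard.2 ⟨Finset.subset_univ _, hR.2⟩, hR'⟩))
      · exact h𝒜.2 hT hR

lemma card_layersLE_eq (hr : r ≤ n) : (layersLE n r).card = (layersGE n (n - r)).card := by
  refine Finset.card_nbij' compl compl (fun x hx ↦ ?_) (fun x hx ↦ ?_)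
    (fun x _ ↦ compl_compl x) (fun x _ ↦ compl_compl x)
  · have := card_compl_add x
    simp only [layersLE, Finset.mem_coe, Finset.mem_filter, Finset.mem_univ, true_and,
      mem_layersGE] at hx ⊢
    omega
  · have := card_compl_add x
    simp only [layersLE, Finset.mem_coe, Finset.mem_filter, Finset.mem_univ, true_and,
      mem_layersGE] at hx ⊢
    omega

lemma card_ballG_le (hn : 0 < n) (r : ℕ) :
    (ballG n r).card ≤ (layersLE n r).card + (n - 1).choose r := by
  let o : Fin n := ⟨0, hn⟩
  refine (Finset.card_union_le _ _).trans (Nat.add_le_add_left ?_ _)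
  have : (n - 1).choose r = ((Finset.univ.erase o).powersetCard r).card := by
    rw [Finset.card_powersetCard, Finset.card_erase_of_mem (Finset.mem_univ _), Finset.card_univ,
      Fintype.card_fin]
  rw [this]
  have hmem : ∀ B ∈ Finset.univ.filter fun B : Finset (Fin n) ↦
      B.card = r + 1 ∧ ∃ i ∈ B, (i : ℕ) = 0, B.card = r + 1 ∧ o ∈ B := by
    intro B hB
    obtain ⟨-, h1, i, hi, hi0⟩ := Finset.mem_filter.1 hB
    have : i = o := Fin.ext hi0
    exact ⟨h1, this ▸ hi⟩
  refine Finset.card_le_card_of_injOn (fun B ↦ B.erase o) (fun B hB ↦ ?_) fun B hB C hC h ↦ ?_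
  · have h1 := hmem B hB
    have h2 := Finset.card_erase_add_one h1.2
    exact Finset.mem_powersetCard.2
      ⟨Finset.erase_subset_erase _ (Finset.subset_univ _), by dsimp only; omega⟩
  · rw [← Finset.insert_erase (hmem B hB).2, ← Finset.insert_erase (hmem C hC).2]
    exact congrArg _ h

/-- The choice s = n - 1 - r makes X^(≥s+1) as large as X^(≤r), and the remainder is at most C(n -
1, r) = C(n - 1, s). -/
lemma exists_generates (hn : 0 < n) (hlow : (layersLE n r).card < m)
    (hupp : m ≤ (ballG n r).card) :
    ∃ (s : ℕ) (𝒜 : Finset (Finset (Fin n))), Generates s 𝒜 m := by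
  have h1 := card_ballG_le hn r
  have hr : r ≤ n - 1 := by
    by_contra h
    rw [Nat.choose_eq_zero_of_lt (by omega)] at h1
    omega
  have h2 : n.choose (n - 1 - r) ≥ (n - 1).choose (n - 1 - r) :=
    Nat.choose_le_choose _ (Nat.sub_le _ _)
  have h3 : (n - 1).choose (n - 1 - r) = (n - 1).choose r := Nat.choose_symm hr
  obtain ⟨𝒜, h𝒜, hc⟩ := exists_isInitSeg_card_eq n (n - 1 - r) (m := m - (layersLE n r).card)
    (by omega)
  refine ⟨n - 1 - r, 𝒜, h𝒜, by omega, fun i ↦ ?_⟩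
  have h4 := card_layersLE_eq (show r ≤ n by omega)
  rw [card_sectionSet h𝒜.1, show n - 1 - r + 1 = n - r by omega, ← h4]
  omega

/-- For s ≥ n both C(n - 1, s) and X^(≥s+1) vanish, leaving section sets of size 0. -/
lemma Generates.lt (hn : 0 < n) (hm : 0 < m) (h : Generates s 𝒜 m) : s < n := by
  by_contra hs
  have h1 := h.2.1
  rw [Nat.choose_eq_zero_of_lt (by omega)] at h1
  have h2 := h.2.2 ⟨0, hn⟩
  have h3 : layersGE n (s + 1) = ∅ := by
    refine Finset.eq_empty_of_forall_notMem fun x hx ↦ ?_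
    rw [mem_layersGE] at hx
    have := card_compl_add x
    omega
  rw [card_sectionSet h.1.1, h3, Finset.card_empty] at h2
  omega

end Hypercube

end

theorem theorem2 (n r : ℕ) (A : Finset (Finset (Fin n)))
    (hlow : (Hypercube.layersLE n r).card < A.card)
    (hupp : A.card ≤ (Hypercube.ballG n r).card) :
    (∃ (s : ℕ) (𝒜 : Finset (Finset (Fin n))), Hypercube.Generates s 𝒜 A.card) ∧
    ∀ (s : ℕ) (𝒜 : Finset (Finset (Fin n))), Hypercube.Generates s 𝒜 A.card →
      (Hypercube.Extremal A ↔
        ∃ i : Fin n, Hypercube.Isomorphic A (Hypercube.sectionSet s 𝒜 i)) := by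
  -- In dimension 0 the cube is a single point, already counted in X^(≤r), so no A is larger.
  have hn : 0 < n := by
    rw [Nat.pos_iff_ne_zero]
    rintro rfl
    have h1 : 0 < (Hypercube.layersLE 0 r).card :=
      Finset.card_pos.2 ⟨∅, Finset.mem_filter.2 ⟨Finset.mem_univ _, by simp⟩⟩
    have h2 := Finset.card_le_univ A
    simp at h2
    omega
  refine ⟨Hypercube.exists_generates hn hlow hupp, fun s 𝒜 h𝒜 ↦ ?_⟩
  have hs := h𝒜.lt hn (by omega)
  constructor
  · exact fun hA ↦ hA.exists_isomorphic_sectionSet h𝒜.1 h𝒜.2.1 hs fun i ↦ (h𝒜.2.2 i).symm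
  · rintro ⟨i, hi⟩
    exact hi.extremal (Hypercube.extremal_sectionSet hs.le h𝒜.1 i)
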